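/- Let $\pi:E\to M$ be a smooth fibre bundle (more generally, a smooth fibred manifold), $\dim M=m$, with fibres of dimension $n$, let $\eta$ be a volume form on $M$, let $k\ge 1$, and let $\mathcal L=L\eta$ with $L:J^k\pi\to\mathbb R$ smooth be a Lagrangian density. Let $\mathcal C\subset J^k\pi$ be a constraint submanifold of codimension $l$, covered by open sets $U_a\subset J^k\pi$ on each of which $\mathcal C$ is the zero set of $l$ smooth functions $\Psi_a^1,\dots,\Psi_a^l$ whose differentials are linearly independent along $\mathcal C$. Let $$W=J^k\pi\times_{J^{k-1}\pi}\Lambda^m_2(J^{k-1}\pi),$$ where $\Lambda^m_2(J^{k-1}\pi)$ is the bundle of $m$-covectors on $J^{k-1}\pi$ that vanish when contracted with two vectors vertical over $M$. Let $\Theta$ be the pull-back to $W$ of the tautological $m$-form of $\Lambda^m_2(J^{k-1}\pi)$, let $\Omega=-d\Theta$, and let $H:W\to\mathbb R$ be the function with $H\eta=\Phi-\mathcal L\circ\mathrm{pr}_1$, where $\Phi(j^k_x\phi,\omega)=(j^{k-1}\phi)^*\omega$. Put $W_0^{\mathcal C}=\{w\in W: \mathrm{pr}_1(w)\in\mathcal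 C,\ H(w)=0\}$. Let $N\subset W_0^{\mathcal C}$, let $X$ assign to each $w\in N$ an $m$-vector $X(w)\in\Lambda^mT_wW$ (for instance, a smooth locally decomposable $m$-vector field along $N$, transverse to $W\to M$ and tangent to $W_0^{\mathcal C}$), and for each $a$ let $\lambda^a_1,\dots,\lambda^a_l$ be real functions on $\{w\in N:\mathrm{pr}_1(w)\in U_a\}$ such that $X$ solves there the constrained dynamical equation $$(-1)^m\, i_{X}\Omega=-\lambda^a_\mu\, d\Psi_a^\mu-dH ,$$ where $i_{X_1\wedge\dots\wedge X_m}\Omega=\Omega(X_1,\dots,X_m,\,\cdot\,)$ and repeated indices are summed. Let $\sigma:M\to W$ be a smooth section of $W\to M$ with values in $N$ that is an integral section of $X$, i.e. for every $x\in M$ the $m$-vector $X(\sigma(x))$ spans $\Lambda^m T_{\sigma(x)}(\sigma(M))$. Then there is a smooth section $\phi$ of $\pi$ such that $\mathrm{pr}_1\circ\sigma=j^k\phi$, and $j^k\phi$ takes values in $\mathcal C$. Moreover, for each $a$, the functions $\tilde\lambda_\mu=\lambda^a_\mu\circ\sigma$ are smooth on $\{x\in M: j^k_x\phi\in U_a\}$,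 and there $\phi$ satisfies the constrained higher-order Euler–Lagrange equations with these multipliers: in every system of adapted coordinates $(x^i,u^\alpha)$, writing $\eta=\rho\,dx^1\wedge\dots\wedge dx^m$, for every $\alpha$, $$\sum_{|J|=0}^{k}(-1)^{|J|}\,(j^{k+|J|}\phi)^*\,\frac{d^{|J|}}{dx^J}\left(\rho\left(\frac{\partial L}{\partial u^\alpha_J}-\tilde\lambda_\mu\frac{\partial \Psi_a^\mu}{\partial u^\alpha_J}\right)\right)=0 ,$$ where $d/dx^i$ are the total derivatives. (In coordinates with $dx^1\wedge\dots\wedge dx^m=\eta$ one has $\rho=1$.) -/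

import Mathlib

open scoped Manifold ContDiff Topology

noncomputable section

namespace FieldTheory

/-! ### Multi-indices and coordinate spaces -/

/-- Multi-indices `I ∈ ℕ^m` of length `|I| ≤ s`. -/
abbrev MIdx (m s : ℕ) : Type := {I : Fin m → ℕ // ∑ i, I i ≤ s}

theorem MIdx.finite (m s : ℕ) : Finite (MIdx m s) := by
  have h : {I : Fin m → ℕ | ∑ i, I i ≤ s}.Finite := by
    refine (Set.finite_Iic (fun _ : Fin m => s)).subset fun I hI i => ?_
    exact (Finset.single_le_sum (f := I) (fun _ _ => Nat.zero_le _) (Finset.mem_univ i)).trans hI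
  exact h.to_subtype

instance (m s : ℕ) : Fintype (MIdx m s) :=
  haveI := MIdx.finite m s
  Fintype.ofFinite _

/-- The length `|I|`. -/
def MIdx.len {m s : ℕ} (I : MIdx m s) : ℕ := ∑ i, I.1 i

/-- The zero multi-index. -/
def MIdx.zero (m s : ℕ) : MIdx m s := ⟨fun _ => 0, by simp⟩

/-- The multi-index `I + 1_i`. -/
def MIdx.addOne {m s : ℕ} (I : MIdx m s) (i : Fin m) : MIdx m (s + 1) :=
  ⟨I.1 + Pi.single i 1, by
    have h := I.2
    simp only [Pi.add_apply, Finset.sum_add_distrib, Finset.sum_pi_single', Finset.mem_univ,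
      if_true]
    omega⟩

/-- A multi-index of length at most `s`, regarded as one of length at most `s + 1`. -/
def MIdx.incl {m s : ℕ} (I : MIdx m s) : MIdx m (s + 1) := ⟨I.1, I.2.trans (Nat.le_succ s)⟩

/-- The list `[1, …, 1, 2, …, 2, …, m, …, m]` in which `i` occurs `I i` times. -/
def idxList {m : ℕ} (I : Fin m → ℕ) : List (Fin m) :=
  (List.finRange m).flatMap fun i => List.replicate (I i) i

/-- The partial derivative `∂^{|I|} f / ∂x₁^{I(1)} ⋯ ∂x_m^{I(m)}`. -/
def pderiv {m : ℕ} (I : Fin m → ℕ) (f : (Fin m → ℝ) → ℝ) : (Fin m → ℝ) → ℝ :=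
  (idxList I).foldr (fun i g => fun z => fderiv ℝ g z (Pi.single i 1)) f

/-- The coordinate space of the `s`-jets: its points are `(x^i, u^α_I)` with `|I| ≤ s`. -/
abbrev JC (m n s : ℕ) : Type := (Fin m → ℝ) × (Fin n → MIdx m s → ℝ)

/-- The coordinate expression `(x^i, u^α_J) ↦ (x^i, u^α_I)` of the projection of `(s+1)`-jets
to `s`-jets. -/
def trunc {m n s : ℕ} : JC m n (s + 1) →L[ℝ] JC m n s :=
  LinearMap.toContinuousLinearMap
    { toFun := fun z => (z.1, fun α I => z.2 α I.incl)
      map_add' := fun _ _ => rfl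
      map_smul' := fun _ _ => rfl }

/-- The coordinate vector `∂/∂u^α_J`. -/
def vertVec {m n s : ℕ} (α : Fin n) (J : MIdx m s) : JC m n s :=
  (0, Pi.single α (Pi.single J 1))

/-- The vector `∂/∂x^i + u^α_{I+1_i} ∂/∂u^α_I` (`|I| ≤ s`) attached to the `(s+1)`-jet with
coordinates `z`.  If `z` represents the `(s+1)`-jet of `φ` at `x`, this is the image of
`∂/∂x^i` under the differential at `x` of `j^s φ`. -/
def holLift {m n s : ℕ} (z : JC m n (s + 1)) (i : Fin m) : JC m n s :=
  (Pi.single i 1, fun α I => z.2 α (I.addOne i))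

/-- The coordinate total derivative `dG/dx^i = ∂G/∂x^i + u^α_{I+1_i} ∂G/∂u^α_I`. -/
def totalDeriv {m n s : ℕ} (i : Fin m) (G : JC m n s → ℝ) : JC m n (s + 1) → ℝ :=
  fun z => fderiv ℝ G (trunc z) (holLift z i)

/-- Iterated total derivatives: `iterTotal [i₁, …, i_q] G = d/dx^{i₁} ⋯ d/dx^{i_q} G`, a function
on jets of order raised by `q`. -/
def iterTotal {m n s : ℕ} : (l : List (Fin m)) → (JC m n s → ℝ) → (JC m n (s + l.length) → ℝ)
  | [], G => G
  | i :: l, G => totalDeriv i (iterTotal l G)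

/-- The space of semi-basic `m`-covectors on the coordinate space of `s`-jets: those which vanish
as soon as two of their arguments are vertical over the base. -/
def SemiBasic (m n s : ℕ) : Submodule ℝ (JC m n s [⋀^Fin m]→L[ℝ] ℝ) where
  carrier := {θ | ∀ (v : Fin m → JC m n s) (i j : Fin m), i ≠ j →
    (v i).1 = 0 → (v j).1 = 0 → θ v = 0}
  zero_mem' := fun _ _ _ _ _ _ => rfl
  add_mem' := fun {a b} ha hb v i j hij hi hj => by
    simp [ha v i j hij hi hj, hb v i j hij hi hj]
  smul_mem' := fun c a ha v i j hij hi hj => by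
    simp [ha v i j hij hi hj]

/-- The normed space underlying `SemiBasic m n s`. -/
def SB (m n s : ℕ) : Type := SemiBasic m n s

instance (m n s : ℕ) : NormedAddCommGroup (SB m n s) :=
  inferInstanceAs (NormedAddCommGroup (SemiBasic m n s))

instance (m n s : ℕ) : NormedSpace ℝ (SB m n s) :=
  inferInstanceAs (NormedSpace ℝ (SemiBasic m n s))

/-- The inclusion of the semi-basic `m`-covectors into all `m`-covectors. -/
def SB.form {m n s : ℕ} : SB m n s →L[ℝ] JC m n s [⋀^Fin m]→L[ℝ] ℝ := (SemiBasic m n s).subtypeL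

/-- The coordinate space of `W = J^{r+1}π ×_{J^rπ} Λ^m_2(J^rπ)`. -/
abbrev WC (m n r : ℕ) : Type := JC m n (r + 1) × SB m n r

/-- Coordinate expression of the projection `W → J^{r}π`. -/
def projWC {m n r : ℕ} : WC m n r →L[ℝ] JC m n r :=
  trunc.comp (ContinuousLinearMap.fst ℝ _ _)

/-- The tautological `m`-form: at `(z, ω)` it is the pull-back of `ω`. -/
def Theta (m n r : ℕ) : WC m n r → WC m n r [⋀^Fin m]→L[ℝ] ℝ :=
  fun w => (SB.form w.2).compContinuousLinearMap projWC

/-- The canonical form `Ω = -dΘ`, pulled back to `W`. -/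
def Omega (m n r : ℕ) : WC m n r → WC m n r [⋀^Fin (m + 1)]→L[ℝ] ℝ :=
  fun w => -extDeriv (Theta m n r) w

/-- The contraction `i_X Ω` of an `m`-vector with an `(m+1)`-covector, evaluated at `v`.  On
decomposable vectors it is `Ω (X₁, …, X_m, v)`, see `contract_ιMulti`. -/
def contract {m : ℕ} {V : Type*} [NormedAddCommGroup V] [NormedSpace ℝ V]
    (Ω : V [⋀^Fin (m + 1)]→L[ℝ] ℝ) (X : ⋀[ℝ]^m V) (v : V) : ℝ :=
  (-1) ^ m * exteriorPower.alternatingMapLinearEquiv (Ω.toAlternatingMap.curryLeft v) X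

theorem contract_ιMulti {m : ℕ} {V : Type*} [NormedAddCommGroup V] [NormedSpace ℝ V]
    (Ω : V [⋀^Fin (m + 1)]→L[ℝ] ℝ) (a : Fin m → V) (v : V) :
    contract Ω (exteriorPower.ιMulti ℝ m a) v = Ω (Fin.snoc a v : Fin (m + 1) → V) := by
  have h := Ω.toAlternatingMap.map_perm (Fin.cons v a : Fin (m + 1) → V) (finRotate (m + 1))
  have e : (Fin.snoc a v : Fin (m + 1) → V) = (Fin.cons v a : Fin (m + 1) → V) ∘
      (finRotate (m + 1)) := by
    rw [Fin.snoc_eq_cons_rotate]; rfl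
  have h2 : Ω (Fin.snoc a v : Fin (m + 1) → V) = Ω.toAlternatingMap
      ((Fin.cons v a : Fin (m + 1) → V) ∘ (finRotate (m + 1))) := by rw [e]; rfl
  rw [h2, h, sign_finRotate, contract, exteriorPower.alternatingMapLinearEquiv_apply_ιMulti,
    Units.smul_def]
  simp [Matrix.vecCons]

/-! ### Fibred manifolds, adapted charts, sections -/

section Charts

variable {m : ℕ} {M : Type*} [TopologicalSpace M] [ChartedSpace (EuclideanSpace ℝ (Fin m)) M]

/-- `b` is a smooth coordinate system on an open subset of `M`. -/
def IsSmoothChart (b : OpenPartialHomeomorph M (Fin m → ℝ)) : Prop :=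
  ContMDiffOn (𝓡 m) 𝓘(ℝ, Fin m → ℝ) ∞ b b.source ∧
  ContMDiffOn 𝓘(ℝ, Fin m → ℝ) (𝓡 m) ∞ b.symm b.target

/-- The coefficient of an `m`-form with respect to `dx¹ ∧ ⋯ ∧ dx^m` in the chart `b`, as a
function of the coordinates. -/
def density (η : ∀ x : M, TangentSpace (𝓡 m) x [⋀^Fin m]→L[ℝ] ℝ)
    (b : OpenPartialHomeomorph M (Fin m → ℝ)) (z : Fin m → ℝ) : ℝ :=
  η (b.symm z) fun i => mfderiv 𝓘(ℝ, Fin m → ℝ) (𝓡 m) b.symm z (Pi.single i (1 : ℝ) : Fin m → ℝ)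

variable (m M) in
/-- A smooth volume form on `M`. -/
structure VolumeForm where
  form : ∀ x : M, TangentSpace (𝓡 m) x [⋀^Fin m]→L[ℝ] ℝ
  smooth : ∀ b : OpenPartialHomeomorph M (Fin m → ℝ), IsSmoothChart b →
    ContDiffOn ℝ ∞ (density form b) b.target
  ne_zero : ∀ b : OpenPartialHomeomorph M (Fin m → ℝ), IsSmoothChart b →
    ∀ z ∈ b.target, density form b z ≠ 0

end Charts

section Fibred

variable (m n : ℕ) {M E : Type*}
  [TopologicalSpace M] [ChartedSpace (EuclideanSpace ℝ (Fin m)) M]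
  [TopologicalSpace E] [ChartedSpace (EuclideanSpace ℝ (Fin (m + n))) E]

/-- Adapted coordinates `(x^i, u^α)` on an open subset of `E`, over coordinates `(x^i)` on an
open subset of `M`. -/
structure AdaptedChart (p : E → M) where
  base : OpenPartialHomeomorph M (Fin m → ℝ)
  total : OpenPartialHomeomorph E ((Fin m → ℝ) × (Fin n → ℝ))
  base_smooth : IsSmoothChart base
  total_smooth : ContMDiffOn (𝓡 (m + n)) 𝓘(ℝ, (Fin m → ℝ) × (Fin n → ℝ)) ∞ total total.source
  total_symm_smooth :
    ContMDiffOn 𝓘(ℝ, (Fin m → ℝ) × (Fin n → ℝ)) (𝓡 (m + n)) ∞ total.symm total.target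
  mem_base : ∀ y ∈ total.source, p y ∈ base.source
  fst_eq : ∀ y ∈ total.source, (total y).1 = base (p y)

variable (M E) in
/-- A smooth fibred manifold `π : E → M` with `dim M = m` and fibres of dimension `n`: a smooth
map with adapted coordinates around every point of `E`.  Every smooth fibre bundle is one. -/
structure FibredManifold where
  proj : E → M
  smooth : ContMDiff (𝓡 (m + n)) (𝓡 m) ∞ proj
  exists_chart : ∀ y : E, ∃ c : AdaptedChart m n proj, y ∈ c.total.source

end Fibred

variable {m n : ℕ} {M E : Type*}
  [TopologicalSpace M] [ChartedSpace (EuclideanSpace ℝ (Fin m)) M]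
  [TopologicalSpace E] [ChartedSpace (EuclideanSpace ℝ (Fin (m + n))) E]

/-- The adapted charts of a fibred manifold. -/
abbrev FibredManifold.Chart (π : FibredManifold m n M E) : Type _ := AdaptedChart m n π.proj

/-- `φ` is a smooth section of `π` on some open neighbourhood of `x` (the values of `φ` away
from `x` are irrelevant). -/
def IsLocalSection (π : FibredManifold m n M E) (x : M) (φ : M → E) : Prop :=
  ∃ U : Set M, IsOpen U ∧ x ∈ U ∧ ContMDiffOn (𝓡 m) (𝓡 (m + n)) ∞ φ U ∧
    ∀ y ∈ U, π.proj (φ y) = y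

/-- `φ` is a (global) smooth section of `π`. -/
def IsSection (π : FibredManifold m n M E) (φ : M → E) : Prop :=
  ContMDiff (𝓡 m) (𝓡 (m + n)) ∞ φ ∧ ∀ y, π.proj (φ y) = y

theorem IsSection.isLocalSection {π : FibredManifold m n M E} {φ : M → E}
    (h : IsSection π φ) (x : M) : IsLocalSection π x φ :=
  ⟨Set.univ, isOpen_univ, Set.mem_univ x, h.1.contMDiffOn, fun y _ => h.2 y⟩

/-- The components `φ^α` of `φ` in an adapted chart, as functions of `(x^i)`. -/
def localExpr {p : E → M} (c : AdaptedChart m n p) (φ : M → E) (α : Fin n) :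
    (Fin m → ℝ) → ℝ :=
  fun z => (c.total (φ (c.base.symm z))).2 α

/-! ### Jets -/

/-- `s`-equivalence at `x`: same value, and same partial derivatives up to order `s` in adapted
coordinates. -/
def jetSetoid (π : FibredManifold m n M E) (s : ℕ) (x : M) :
    Setoid {φ : M → E // IsLocalSection π x φ} where
  r φ ψ := φ.1 x = ψ.1 x ∧ ∀ c : π.Chart, φ.1 x ∈ c.total.source →
    ∀ (α : Fin n) (I : MIdx m s),
      pderiv I.1 (localExpr c φ.1 α) (c.base x) = pderiv I.1 (localExpr c ψ.1 α) (c.base x)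
  iseqv :=
    { refl := fun _ => ⟨rfl, fun _ _ _ _ => rfl⟩
      symm := fun h => ⟨h.1.symm, fun c hc α I => (h.2 c (by rw [h.1]; exact hc) α I).symm⟩
      trans := fun h h' => ⟨h.1.trans h'.1, fun c hc α I =>
        (h.2 c hc α I).trans (h'.2 c (by rw [← h.1]; exact hc) α I)⟩ }

/-- The jet space `J^s π`. -/
structure Jet (π : FibredManifold m n M E) (s : ℕ) where
  pt : M
  cls : Quotient (jetSetoid π s pt)

/-- The `s`-th lift `j^s φ` of a section, at `x`. -/
def jetLift {π : FibredManifold m n M E} (s : ℕ) {φ : M → E} (hφ : IsSection π φ) (x : M) :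
    Jet π s :=
  ⟨x, Quotient.mk _ ⟨φ, hφ.isLocalSection x⟩⟩

namespace Jet

variable {π : FibredManifold m n M E} {s : ℕ}

/-- The projection `J^s π → E`. -/
def val (j : Jet π s) : E :=
  Quotient.lift (s := jetSetoid π s j.pt) (fun φ => φ.1 j.pt) (fun _ _ h => h.1) j.cls

/-- The projection `J^{s+1} π → J^s π`. -/
def proj (j : Jet π (s + 1)) : Jet π s :=
  ⟨j.pt, Quotient.map (sa := jetSetoid π (s + 1) j.pt) (sb := jetSetoid π s j.pt) id
    (fun _ _ h => ⟨h.1, fun c hc α I => h.2 c hc α I.incl⟩) j.cls⟩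

/-- The domain in `J^s π` of the coordinates induced by an adapted chart. -/
def dom (s : ℕ) (c : π.Chart) : Set (Jet π s) := {j | j.val ∈ c.total.source}

/-- The coordinates `(x^i, u^α_I)` on `J^s π` induced by an adapted chart (meaningful on
`Jet.dom`). -/
def coord (c : π.Chart) (j : Jet π s) : JC m n s :=
  (c.base j.pt, fun α I => pderiv I.1 (localExpr c (Quotient.out j.cls).1 α) (c.base j.pt))

open Classical in
/-- The coordinate expression of a map on `J^s π` in the coordinates induced by `c`. -/
def rep {F : Type*} [Zero F] (c : π.Chart) (f : Jet π s → F) (z : JC m n s) : F :=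
  if h : ∃ j ∈ dom s c, coord c j = z then f h.choose else 0

/-- The manifold topology of `J^s π`: a set is open iff it is open in all induced coordinates. -/
instance : TopologicalSpace (Jet π s) where
  IsOpen U := ∀ j ∈ U, ∀ c : π.Chart, j ∈ dom s c →
    ∀ᶠ z in 𝓝 (coord c j), ∀ j' ∈ dom s c, coord c j' = z → j' ∈ U
  isOpen_univ := fun _ _ _ _ => Filter.Eventually.of_forall fun _ _ _ _ => Set.mem_univ _
  isOpen_inter := fun U V hU hV j hj c hc => by
    filter_upwards [hU j hj.1 c hc, hV j hj.2 c hc] with z h1 h2 j' hj' e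
    exact ⟨h1 j' hj' e, h2 j' hj' e⟩
  isOpen_sUnion := fun S hS j ⟨U, hU, hj⟩ c hc => by
    filter_upwards [hS U hU j hj c hc] with z h1 j' hj' e
    exact ⟨U, hU, h1 j' hj' e⟩

/-- Smoothness on an (open) set of a real function on `J^s π`. -/
def SmoothOn (f : Jet π s → ℝ) (U : Set (Jet π s)) : Prop :=
  ∀ j ∈ U, ∀ c : π.Chart, j ∈ dom s c → ContDiffAt ℝ ∞ (rep c f) (coord c j)

end Jet

/-! ### The space `W` -/

/-- The fibred product `W = J^{r+1}π ×_{J^rπ} Λ^m_2(J^rπ)`.  The `m`-covector at the `r`-jet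
`jet.proj` is given by its expressions in all the induced charts at that point, which are related by
the transformation law of covariant tensors. -/
structure W (π : FibredManifold m n M E) (r : ℕ) where
  jet : Jet π (r + 1)
  mom : π.Chart → SB m n r
  compat : ∀ c c' : π.Chart, jet.proj ∈ Jet.dom r c → jet.proj ∈ Jet.dom r c' →
    SB.form (mom c) = (SB.form (mom c')).compContinuousLinearMap
        (fderiv ℝ (Jet.rep c (Jet.coord c')) (Jet.coord c jet.proj))
  zero_off : ∀ c : π.Chart, jet.proj ∉ Jet.dom r c → mom c = 0

namespace W

variable {π : FibredManifold m n M E} {r : ℕ}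

/-- The domain in `W` of the coordinates induced by an adapted chart. -/
def dom (c : π.Chart) : Set (W π r) := {w | w.jet ∈ Jet.dom (r + 1) c}

/-- The coordinates on `W` induced by an adapted chart. -/
def coord (c : π.Chart) (w : W π r) : WC m n r := (Jet.coord c w.jet, w.mom c)

open Classical in
/-- The change of coordinates on `W` from those induced by `c` to those induced by `c'`. -/
def transition (c c' : π.Chart) (z : WC m n r) : WC m n r :=
  if h : ∃ w ∈ dom c, coord c w = z then coord c' h.choose else 0

/-- An element of `Λ^m T_w W`, given by its expressions in all the induced charts, which are
related by the transformation law of contravariant tensors. -/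
structure MultiVector (w : W π r) where
  val : π.Chart → ⋀[ℝ]^m (WC m n r)
  compat : ∀ c c' : π.Chart, w ∈ dom c → w ∈ dom c' →
    val c' = exteriorPower.map m (fderiv ℝ (transition c c') (coord c w)).toLinearMap (val c)
  zero_off : ∀ c : π.Chart, w ∉ dom c → val c = 0

/-- The coordinate expression of a section `σ` of `W → M`. -/
def secExpr (c : π.Chart) (σ : M → W π r) : (Fin m → ℝ) → WC m n r :=
  fun z => coord c (σ (c.base.symm z))

/-- `σ` is a smooth section of `W → M`. -/
def IsSection (σ : M → W π r) : Prop :=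
  (∀ x, (σ x).jet.pt = x) ∧
  ∀ (c : π.Chart) (x : M), σ x ∈ dom c →
    ∀ᶠ z in 𝓝 (c.base x), σ (c.base.symm z) ∈ dom c ∧ ContDiffAt ℝ ∞ (secExpr c σ) z

/-- `σ` is an integral section of the `m`-vector field `X`: at each point `σ x`, the `m`-vector `X`
spans `Λ^m` of the tangent space of the image of `σ`. -/
def IsIntegralSection (X : ∀ w : W π r, MultiVector w) (σ : M → W π r) : Prop :=
  IsSection σ ∧ ∀ (x : M) (c : π.Chart), σ x ∈ dom c → ∃ f : ℝ, f ≠ 0 ∧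
    (X (σ x)).val c = f • exteriorPower.ιMulti ℝ m
      (fun i : Fin m => fderiv ℝ (secExpr c σ) (c.base x) (Pi.single i 1))

/-- The coefficient with respect to `dx¹ ∧ ⋯ ∧ dx^m` of the pairing
`Φ(j^{r+1}_xφ, ω) = (j^rφ)^* ω`, in coordinates. -/
def pairing (z : WC m n r) : ℝ :=
  SB.form z.2 (holLift z.1)

/-- The coordinate expression of the function `H` on `W` given by `Φ - L η = H η`. -/
def ham (η : VolumeForm m M) (L : Jet π (r + 1) → ℝ) (c : π.Chart) (z : WC m n r) : ℝ :=
  pairing z / density η.form c.base z.1.1 - Jet.rep c L z.1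

/-- The set `W_0^C` of points of `W` over `C` at which `H` vanishes. -/
def constrained (η : VolumeForm m M) (L : Jet π (r + 1) → ℝ) (C : Set (Jet π (r + 1))) :
    Set (W π r) :=
  {w | w.jet ∈ C ∧ ∀ c : π.Chart, w ∈ dom c → ham η L c (coord c w) = 0}

/-- The constrained dynamical equation `(-1)^m i_X Ω = -λ_μ dΨ^μ - dH` at the point `w`. -/
def DynamicalEq {l : ℕ} (η : VolumeForm m M) (L : Jet π (r + 1) → ℝ)
    (Ψ : Fin l → Jet π (r + 1) → ℝ) (lam : Fin l → ℝ) {w : W π r} (X : MultiVector w) : Prop :=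
  ∀ c : π.Chart, w ∈ dom c → ∀ V : WC m n r,
    (-1) ^ m * contract (Omega m n r (coord c w)) (X.val c) V =
      -(∑ μ, lam μ * fderiv ℝ (fun z : WC m n r => Jet.rep c (Ψ μ) z.1) (coord c w) V)
        - fderiv ℝ (ham η L c) (coord c w) V

end W

/-! ### Constraints and the Euler–Lagrange equations -/

/-- Local constraint functions for `C`: on the open set `U`, the set `C` is the zero set of the `l`
functionally independent smooth functions `Ψ^μ`. -/
structure LocalConstraint {π : FibredManifold m n M E} {k : ℕ} (C : Set (Jet π k)) (l : ℕ) where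
  U : Set (Jet π k)
  isOpen_U : IsOpen U
  Ψ : Fin l → Jet π k → ℝ
  smooth : ∀ μ, Jet.SmoothOn (Ψ μ) U
  mem_iff : ∀ j ∈ U, j ∈ C ↔ ∀ μ, Ψ μ j = 0
  indep : ∀ j ∈ U ∩ C, ∀ c : π.Chart, j ∈ Jet.dom k c →
    LinearIndependent ℝ fun μ => fderiv ℝ (Jet.rep c (Ψ μ)) (Jet.coord c j)

/-- The constrained higher-order Euler–Lagrange equations at `x` in the adapted chart `c`,
`(j^{2k}φ)^* ∑_J (-1)^{|J|} d^{|J|}/dx^J (ρ (∂L/∂u^α_J - λ_μ ∂Ψ^μ/∂u^α_J)) = 0` for all `α`.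
Here `ρ` is the coefficient of `η` in the chart, so that the Lagrangian density is
`ρ L dx¹ ∧ ⋯ ∧ dx^m`; `ρ = 1` in charts compatible with `η`.  The multipliers `λ_μ` are functions
on `M`.  The term of index `J` is a function on jets of order `k + |J|`. -/
def EulerLagrangeAt {π : FibredManifold m n M E} {k l : ℕ} (η : VolumeForm m M)
    (L : Jet π k → ℝ) (Ψ : Fin l → Jet π k → ℝ) (lam : M → Fin l → ℝ)
    {φ : M → E} (hφ : IsSection π φ) (c : π.Chart) (x : M) : Prop :=
  ∀ α : Fin n, ∑ J : MIdx m k, (-1 : ℝ) ^ J.len *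
    iterTotal (idxList J.1)
      (fun z : JC m n k => density η.form c.base z.1 *
        (fderiv ℝ (Jet.rep c L) z (vertVec α J) -
          ∑ μ, lam (c.base.symm z.1) μ * fderiv ℝ (Jet.rep c (Ψ μ)) z (vertVec α J)))
      (Jet.coord c (jetLift (k + (idxList J.1).length) hφ x)) = 0

end FieldTheory

end

noncomputable section

namespace FieldTheory

section

variable {m n r s : ℕ}

/-! ### Semi-basic covectors -/

/-! In adapted coordinates a section of `W` is a pair (jet coordinates, momenta), and its tangent
frame `D` is normalised over the base. The canonical form has constant coefficients up to the
projection to `r`-jets, so its contraction with `D` is explicit (`Omega_snoc`), and the dynamical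
equation can be tested on four kinds of vectors.

Momentum directions: the form dx¹ ∧ ⋯ ∧ dx^m fixes the scale of the `m`-vector by `f * ρ = 1`, and
the contact forms give ∂u_I/∂x^i = u_{I+1_i} (`dynamical_holonomic`). Hence the jet component of the
section is the prolongation of its underlying section φ.

Directions ∂/∂u_J: one gets ρ(∂L/∂u_J − λ_μ ∂Ψ^μ/∂u_J) = ∑_i ∂_i p^{J,i} + ∑_{I+1_i=J} p^{I,i}
(`dynamical_vertical`). Applying (-1)^{|J|} ∂_J and summing over J, each momentum occurs twice with
opposite signs (`sum_listDeriv_divergence`); what remains is the Euler–Lagrange equation.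

Directions tangent to the section: Ω has a repeated argument, so λ_μ dΨ^μ equals −dH there. Together
with the directions ∂/∂u_J these span, so λ_μ dΨ^μ is smooth along the section, and independence of
the dΨ^μ yields smooth λ by Cramer's rule (`contDiffAt_multiplier`). This smoothness is what lets
partial derivatives along φ be rewritten as iterated total derivatives (`iterTotal_prolong`). -/

theorem SB.form_eq_zero (κ : SB m n s) {v : Fin m → JC m n s} {i j : Fin m} (hij : i ≠ j)
    (hi : (v i).1 = 0) (hj : (v j).1 = 0) : SB.form κ v = 0 :=
  κ.2 v i j hij hi hj

/-- With one slot already vertical, a second vertical argument kills the form. The vertical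
corrections can therefore be added one slot at a time without effect. -/
theorem SB.form_update_add_vertical (κ : SB m n s) (p w : Fin m → JC m n s)
    (hw : ∀ j, (w j).1 = 0) (i : Fin m) {v : JC m n s} (hv : v.1 = 0) :
    SB.form κ (Function.update (p + w) i v) = SB.form κ (Function.update p i v) := by
  have key : ∀ T : Finset (Fin m),
      SB.form κ (Function.update (fun j => if j ∈ T then p j + w j else p j) i v) =
        SB.form κ (Function.update p i v) := by
    intro T
    induction T using Finset.induction_on with
    | empty => simp
    | insert a T ha ih =>
      set q : Fin m → JC m n s := fun j => if j ∈ T then p j + w j else p j with hq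
      have e : (fun j => if j ∈ insert a T then p j + w j else p j) =
          Function.update q a (q a + w a) := by
        funext j
        by_cases hj : j = a
        · subst hj; simp [hq, ha]
        · simp [hq, hj]
      rw [e]
      by_cases hai : a = i
      · subst hai
        rw [Function.update_idem, ih]
      · rw [Function.update_comm hai, ContinuousAlternatingMap.map_update_add,
          Function.update_comm (Ne.symm hai), Function.update_eq_self, ih,
          add_eq_left]
        refine SB.form_eq_zero κ (i := i) (j := a) (Ne.symm hai) ?_ ?_
        · simp [Function.update_of_ne (Ne.symm hai), hv]
        · simp [hw]
  have := key Finset.univ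
  simpa [funext_iff, Pi.add_def] using this

/-- In the multilinear expansion every term with two or more vertical arguments vanishes, so only
the terms of order zero and one survive. -/
theorem SB.form_add_vertical (κ : SB m n s) (p w : Fin m → JC m n s)
    (hw : ∀ j, (w j).1 = 0) :
    SB.form κ (p + w) = SB.form κ p + ∑ i, SB.form κ (Function.update p i (w i)) := by
  have key : ∀ T : Finset (Fin m),
      SB.form κ (p + fun j => if j ∈ T then w j else 0) =
        SB.form κ p + ∑ i ∈ T, SB.form κ (Function.update p i (w i)) := by
    intro T
    induction T using Finset.induction_on with
    | empty => simp [← Pi.zero_def]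
    | insert a T ha ih =>
      set q : Fin m → JC m n s := fun j => if j ∈ T then w j else 0 with hq
      have e : (p + fun j => if j ∈ insert a T then w j else 0) =
          Function.update (p + q) a ((p + q) a + w a) := by
        funext j
        by_cases hj : j = a
        · subst hj; simp [hq, ha]
        · simp [hq, hj]
      have hq0 : ∀ j, (q j).1 = 0 := fun j => by
        by_cases hj : j ∈ T <;> simp [hq, hj, hw]
      rw [e, ContinuousAlternatingMap.map_update_add, Function.update_eq_self, ih,
        SB.form_update_add_vertical κ p q hq0 a (hw a), Finset.sum_insert ha]
      ring
  simpa using key Finset.univ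

/-- The coordinate vector `∂/∂x^i`. -/
def baseVec (i : Fin m) : JC m n s := (Pi.single i 1, 0)

/-- The evaluation of semi-basic covectors on an `m`-tuple of vectors. -/
def SB.eval (v : Fin m → JC m n s) : SB m n s →L[ℝ] ℝ :=
  (ContinuousAlternatingMap.apply ℝ (JC m n s) ℝ v).comp SB.form

/-- The momentum coordinate `p^{I,i}_α`. -/
def SB.mom (α : Fin n) (I : MIdx m s) (i : Fin m) : SB m n s →L[ℝ] ℝ :=
  SB.eval (Function.update baseVec i (vertVec α I))

theorem vertical_eq_sum (q : Fin n → MIdx m s → ℝ) :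
    ((0, q) : JC m n s) = ∑ α, ∑ I, q α I • vertVec α I := by
  have h : ∀ (α : Fin n) (I : MIdx m s), q α I • (vertVec α I : JC m n s) =
      (0, Pi.single α (Pi.single I (q α I))) := by
    intro α I
    ext β J
    · simp [vertVec]
    · by_cases hβ : β = α
      · subst hβ
        by_cases hJ : J = I
        · subst hJ; simp [vertVec]
        · simp [vertVec, hJ]
      · simp [vertVec, hβ]
  simp only [h]
  ext β J
  · simp [Prod.fst_sum]
  · simp only [Prod.snd_sum, Finset.sum_apply]
    rw [Finset.sum_eq_single β, Finset.sum_eq_single J]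
    · simp
    · intro b _ hb; simp [hb.symm]
    · simp
    · intro b _ hb; simp [hb.symm]
    · simp

theorem SB.form_update_baseVec (κ : SB m n s) (i : Fin m) (q : Fin n → MIdx m s → ℝ) :
    SB.form κ (Function.update baseVec i (0, q)) = ∑ α, ∑ I, q α I * SB.mom α I i κ := by
  have h : ∀ v, SB.form κ (Function.update baseVec i v) =
      (SB.form κ).toMultilinearMap.toLinearMap baseVec i v := fun _ => rfl
  rw [vertical_eq_sum, h, map_sum]
  refine Finset.sum_congr rfl fun α _ => ?_
  rw [map_sum]
  refine Finset.sum_congr rfl fun I _ => ?_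
  rw [map_smul]
  rfl

/-- `m` vectors projecting to the coordinate frame of the base. -/
def frame (q : Fin m → Fin n → MIdx m s → ℝ) (i : Fin m) : JC m n s := (Pi.single i 1, q i)

theorem frame_eq (q : Fin m → Fin n → MIdx m s → ℝ) :
    frame q = baseVec + fun i => ((0, q i) : JC m n s) := by
  funext i; simp [frame, baseVec]

/-- Used for two frames: the holonomic one, whose value is the pairing Φ, and the projected tangent
frame of a section. -/
theorem SB.form_frame (κ : SB m n s) (q : Fin m → Fin n → MIdx m s → ℝ) :
    SB.form κ (frame q) = SB.eval baseVec κ + ∑ i, ∑ α, ∑ I, q i α I * SB.mom α I i κ := by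
  rw [frame_eq, SB.form_add_vertical _ _ _ (fun _ => rfl)]
  simp only [SB.form_update_baseVec]
  rfl

theorem SB.form_update_frame (κ : SB m n s) (q : Fin m → Fin n → MIdx m s → ℝ) (i : Fin m)
    (v : Fin n → MIdx m s → ℝ) :
    SB.form κ (Function.update (frame q) i (0, v)) = ∑ α, ∑ I, v α I * SB.mom α I i κ := by
  rw [frame_eq, SB.form_update_add_vertical _ _ _ (fun _ => rfl) _ rfl, SB.form_update_baseVec]

/-- The determinant as a continuous alternating form. -/
def detForm (m : ℕ) : (Fin m → ℝ) [⋀^Fin m]→L[ℝ] ℝ :=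
  { (Matrix.detRowAlternating : (Fin m → ℝ) [⋀^Fin m]→ₗ[ℝ] ℝ) with
    cont := Continuous.matrix_det continuous_id }

/-- The map `(x, u) ↦ x` with the `i`-th component replaced by `u^α_I`. -/
def replaceComp (α : Fin n) (I : MIdx m s) (i : Fin m) : JC m n s →L[ℝ] (Fin m → ℝ) :=
  LinearMap.toContinuousLinearMap
    { toFun := fun z => Function.update z.1 i (z.2 α I)
      map_add' := fun a b => by
        funext j; by_cases h : j = i
        · subst h; simp
        · simp [h]
      map_smul' := fun c a => by
        funext j; by_cases h : j = i
        · subst h; simp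
        · simp [h] }

theorem replaceComp_apply (α : Fin n) (I : MIdx m s) (i : Fin m) (z : JC m n s) :
    replaceComp α I i z = Function.update z.1 i (z.2 α I) := rfl

variable (m n s) in
/-- The semi-basic form `dx¹ ∧ ⋯ ∧ dx^m`. -/
def SB.vol : SB m n s :=
  ⟨(detForm m).compContinuousLinearMap (ContinuousLinearMap.fst ℝ _ _), by
    intro v i j _ hi _
    exact (detForm m).map_coord_zero i hi⟩

/-- The semi-basic form `du^α_I ∧ i_{∂/∂x^i} (dx¹ ∧ ⋯ ∧ dx^m)`. -/
def SB.contact (α : Fin n) (I : MIdx m s) (i : Fin m) : SB m n s :=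
  ⟨(detForm m).compContinuousLinearMap (replaceComp α I i), by
    intro v a b hab ha hb
    -- All vertical vectors are sent to the line spanned by the `i`-th basis vector, so two of them
    -- give proportional rows of the determinant.
    have h : ∀ c, (v c).1 = 0 → replaceComp α I i (v c) = (v c).2 α I • Pi.single i 1 := by
      intro c hc
      rw [replaceComp_apply, hc]
      funext j; by_cases h : j = i
      · subst h; simp
      · simp [h]
    set q : Fin m → Fin m → ℝ := fun c => replaceComp α I i (v c) with hq
    have e : q = Function.update (Function.update q a
        ((v a).2 α I • Pi.single i 1)) b ((v b).2 α I • Pi.single i 1) := by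
      rw [← h a ha, ← h b hb]
      change q = Function.update (Function.update q a (q a)) b (q b)
      rw [Function.update_eq_self, Function.update_eq_self]
    change detForm m q = 0
    rw [e, ContinuousAlternatingMap.map_update_smul, Function.update_comm hab,
      ContinuousAlternatingMap.map_update_smul,
      (detForm m).map_eq_zero_of_eq _ (i := a) (j := b) _ hab]
    · simp
    · simp [Function.update_of_ne (Ne.symm hab)]⟩

theorem SB.form_vol_frame (q : Fin m → Fin n → MIdx m s → ℝ) :
    SB.form (SB.vol m n s) (frame q) = 1 := by
  change Matrix.det (Matrix.of fun i => (frame q i).1) = 1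
  have : (Matrix.of fun i => (frame q i).1) = (1 : Matrix (Fin m) (Fin m) ℝ) := by
    ext i j
    simp [frame, Pi.single_apply, Matrix.one_apply, eq_comm]
  rw [this, Matrix.det_one]

theorem SB.form_contact_frame (q : Fin m → Fin n → MIdx m s → ℝ) (α : Fin n) (I : MIdx m s)
    (i : Fin m) : SB.form (SB.contact α I i) (frame q) = q i α I := by
  change Matrix.det (Matrix.of fun j => replaceComp α I i (frame q j)) = q i α I
  have : (Matrix.of fun j => replaceComp α I i (frame q j)) =
      (1 : Matrix (Fin m) (Fin m) ℝ).updateCol i (fun j => q j α I) := by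
    ext a b
    simp only [replaceComp_apply, frame, Matrix.of_apply, Matrix.updateCol_apply,
      Function.update_apply, Pi.single_apply, Matrix.one_apply, eq_comm]
  rw [this, ← Matrix.cramer_apply, Matrix.cramer_one]
  rfl

/-! ### The canonical form -/

/-- The tautological form is a linear function of the point of `W`, through its momentum component
alone. Its derivative is therefore that same linear map, and the exterior derivative is the
alternating sum. -/
theorem Omega_apply (w : WC m n r) (v : Fin (m + 1) → WC m n r) :
    Omega m n r w v =
      -∑ i : Fin (m + 1), (-1) ^ (i : ℕ) * SB.form (v i).2 (fun j => projWC (i.removeNth v j)) := by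
  have hT : Theta m n r =
      ((ContinuousAlternatingMap.compContinuousLinearMapCLM (F := ℝ) (projWC (m := m) (n := n)
        (r := r))).comp SB.form).comp (ContinuousLinearMap.snd ℝ _ _) := rfl
  rw [Omega, ContinuousAlternatingMap.neg_apply, extDeriv,
    ContinuousAlternatingMap.alternatizeUncurryFin_apply, hT, ContinuousLinearMap.fderiv]
  simp only [zsmul_eq_mul, Int.cast_pow, Int.cast_neg, Int.cast_one]
  rfl

/-- The sign for moving the last vector to slot `i` comes from the tuple in which `v` occupies both
slots: omitting either copy gives the two sides up to sign, and the signed sum vanishes. -/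
theorem removeNth_castSucc_snoc {E : Type*} [NormedAddCommGroup E] [NormedSpace ℝ E]
    (g : E [⋀^Fin m]→L[ℝ] ℝ) (p : Fin m → E) (v : E) (i : Fin m) :
    (-1) ^ (i : ℕ) * g (i.castSucc.removeNth (Fin.snoc p v : Fin (m + 1) → E)) =
      -((-1) ^ m * g (Function.update p i v)) := by
  have h := g.neg_one_pow_smul_map_removeNth_add_eq_zero_of_eq
    (v := (Fin.snoc (Function.update p i v) v : Fin (m + 1) → E)) (i := i.castSucc)
    (j := Fin.last m) (by simp) (Fin.castSucc_lt_last i).ne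
  have e1 : (Fin.last m).removeNth (Fin.snoc (Function.update p i v) v : Fin (m + 1) → E) =
      Function.update p i v := by
    funext j; simp [Fin.removeNth]
  have e2 : i.castSucc.removeNth (Fin.snoc (Function.update p i v) v : Fin (m + 1) → E) =
      i.castSucc.removeNth (Fin.snoc p v : Fin (m + 1) → E) := by
    rw [Fin.snoc_update, Fin.removeNth_update]
  rw [e1, e2] at h
  simp only [Fin.val_castSucc, Fin.val_last, zsmul_eq_mul, Int.cast_pow, Int.cast_neg, Int.cast_one]
    at h
  linarith

theorem Omega_snoc (w : WC m n r) (D : Fin m → WC m n r) (V : WC m n r) :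
    (-1) ^ m * Omega m n r w (Fin.snoc D V : Fin (m + 1) → WC m n r) =
      (∑ i, SB.form (D i).2 (Function.update (fun j => projWC (D j)) i (projWC V))) -
        SB.form V.2 (fun j => projWC (D j)) := by
  rw [Omega_apply, Fin.sum_univ_castSucc]
  have e : ∀ i : Fin (m + 1), (fun j => projWC (i.removeNth (Fin.snoc D V : Fin (m + 1) → WC m n r) j))
      = i.removeNth (Fin.snoc (fun j => projWC (D j)) (projWC V) : Fin (m + 1) → JC m n r) := by
    intro i
    have := Fin.comp_snoc (α := WC m n r) (β := JC m n r) projWC D V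
    funext j
    exact congrFun this (i.succAbove j)
  have e1 : (Fin.last m).removeNth
      (Fin.snoc (fun j => projWC (D j)) (projWC V) : Fin (m + 1) → JC m n r) =
        fun j => projWC (D j) := by
    funext j; simp [Fin.removeNth]
  have hs : ((-1 : ℝ) ^ m) * (-1) ^ m = 1 := by rw [← mul_pow]; simp
  simp only [e, Fin.val_castSucc, Fin.snoc_castSucc, Fin.snoc_last, removeNth_castSucc_snoc, e1,
    Fin.val_last, Finset.sum_neg_distrib, ← Finset.mul_sum]
  linear_combination ((∑ i, SB.form (D i).2 (Function.update (fun j => projWC (D j)) i (projWC V))) -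
        SB.form V.2 (fun j => projWC (D j))) * hs

end

section

variable {m n r s : ℕ}

/-! ### The Hamiltonian in coordinates -/

theorem fderiv_eq_of_affine {F : Type*} [NormedAddCommGroup F] [NormedSpace ℝ F] {f : F → ℝ}
    {z V : F} {b : ℝ} (hf : DifferentiableAt ℝ f z) (h : ∀ t : ℝ, f (z + t • V) = f z + t * b) :
    fderiv ℝ f z V = b := by
  rw [← hf.lineDeriv_eq_fderiv]
  refine HasLineDerivAt.lineDeriv ?_
  unfold HasLineDerivAt
  simp only [h]
  simpa using ((hasDerivAt_id (0 : ℝ)).mul_const b).const_add (f z)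

theorem pairing_eq (w : WC m n r) :
    W.pairing w = SB.eval baseVec w.2 +
      ∑ i, ∑ α, ∑ I : MIdx m r, w.1.2 α (I.addOne i) * SB.mom α I i w.2 :=
  SB.form_frame w.2 fun i α I => w.1.2 α (I.addOne i)

theorem contDiff_coeff (α : Fin n) (J : MIdx m s) :
    ContDiff ℝ ∞ fun z : JC m n s => z.2 α J := by
  fun_prop

theorem contDiff_pairing : ContDiff ℝ ∞ (W.pairing : WC m n r → ℝ) := by
  have : (W.pairing : WC m n r → ℝ) = fun w => SB.eval baseVec w.2 +
      ∑ i, ∑ α, ∑ I : MIdx m r, w.1.2 α (I.addOne i) * SB.mom α I i w.2 := funext pairing_eq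
  rw [this]
  refine ((SB.eval _).contDiff.comp contDiff_snd).add ?_
  refine ContDiff.sum fun i _ => ContDiff.sum fun α _ => ContDiff.sum fun I _ => ?_
  exact ((contDiff_coeff α (I.addOne i)).comp contDiff_fst).mul
    ((SB.mom α I i).contDiff.comp contDiff_snd)

/-- The coordinate expression of `H` for a density `ρ` and a Lagrangian `L` given in
coordinates. -/
def localHam (ρ : (Fin m → ℝ) → ℝ) (L : JC m n (r + 1) → ℝ) (w : WC m n r) : ℝ :=
  W.pairing w / ρ w.1.1 - L w.1

section

variable {ρ : (Fin m → ℝ) → ℝ} {L : JC m n (r + 1) → ℝ} {w : WC m n r}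

theorem contDiffAt_localHam (hρ : ContDiffAt ℝ ∞ ρ w.1.1) (hρ0 : ρ w.1.1 ≠ 0)
    (hL : ContDiffAt ℝ ∞ L w.1) : ContDiffAt ℝ ∞ (localHam ρ L) w := by
  have h1 : ContDiffAt ℝ ∞ (fun w : WC m n r => ρ w.1.1) w :=
    ContDiffAt.comp (g := ρ) (f := fun w : WC m n r => w.1.1) w hρ (by fun_prop)
  have h2 : ContDiffAt ℝ ∞ (fun w : WC m n r => L w.1) w :=
    ContDiffAt.comp (g := L) (f := fun w : WC m n r => w.1) w hL (by fun_prop)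
  exact (contDiff_pairing.contDiffAt.div h1 hρ0).sub h2

/-- A direction vertical over the base leaves `ρ` unchanged, so the quotient is affine along it
whenever the pairing is. -/
theorem fderiv_localHam_of_vertical (hρ : DifferentiableAt ℝ ρ w.1.1) (hρ0 : ρ w.1.1 ≠ 0)
    (hL : DifferentiableAt ℝ L w.1) {V : WC m n r} (hV : V.1.1 = 0) {b : ℝ}
    (hb : ∀ t : ℝ, W.pairing (w + t • V) = W.pairing w + t * b) :
    fderiv ℝ (localHam ρ L) w V = b / ρ w.1.1 - fderiv ℝ L w.1 V.1 := by
  have h1 : DifferentiableAt ℝ (fun w : WC m n r => ρ w.1.1) w :=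
    DifferentiableAt.comp (g := ρ) (f := fun w : WC m n r => w.1.1) w hρ (by fun_prop)
  have h2 : HasFDerivAt (fun w : WC m n r => L w.1)
      ((fderiv ℝ L w.1).comp (ContinuousLinearMap.fst ℝ _ _)) w :=
    HasFDerivAt.comp (g := L) w hL.hasFDerivAt hasFDerivAt_fst
  have h3 : DifferentiableAt ℝ (fun w : WC m n r => W.pairing w / ρ w.1.1) w :=
    by
    simp only [div_eq_mul_inv]
    exact (contDiff_pairing.contDiffAt.differentiableAt (by simp)).mul (h1.fun_inv hρ0)
  have h4 : fderiv ℝ (fun w : WC m n r => W.pairing w / ρ w.1.1) w V = b / ρ w.1.1 := by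
    refine fderiv_eq_of_affine h3 fun t => ?_
    simp only [hb, Prod.fst_add, Prod.smul_fst, hV, smul_zero, add_zero]
    ring
  have h5 := h3.hasFDerivAt.sub h2
  have h6 : localHam ρ L = (fun w : WC m n r => W.pairing w / ρ w.1.1) - fun w => L w.1 := rfl
  rw [h6, h5.fderiv]
  simp [h4]

/-! ### Components of the dynamical equation -/

variable {D : Fin m → WC m n r} {f : ℝ} {P : JC m n (r + 1) →L[ℝ] ℝ}

theorem projWC_frame (hD : ∀ i, (D i).1.1 = Pi.single i 1) :
    (fun j => projWC (D j)) = frame fun i α I => (D i).1.2 α I.incl := by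
  funext i
  exact Prod.ext (hD i) rfl

/-- For `V = (0, κ)` the constraint and Lagrangian terms vanish. What is left compares the value of
`κ` on the actual tangent frame with its value on the holonomic frame, up to scale. -/
theorem dynamical_momentum (hρ : DifferentiableAt ℝ ρ w.1.1) (hρ0 : ρ w.1.1 ≠ 0)
    (hL : DifferentiableAt ℝ L w.1) (hD : ∀ i, (D i).1.1 = Pi.single i 1)
    (h : ∀ V : WC m n r, f * ((-1) ^ m * Omega m n r w (Fin.snoc D V : Fin (m + 1) → WC m n r)) =
      -P V.1 - fderiv ℝ (localHam ρ L) w V) (κ : SB m n r) :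
    f * SB.form κ (frame fun i α I => (D i).1.2 α I.incl) =
      SB.form κ (frame fun i α I => w.1.2 α (I.addOne i)) / ρ w.1.1 := by
  have h1 := h (0, κ)
  have hb : ∀ t : ℝ, W.pairing (w + t • ((0, κ) : WC m n r)) = W.pairing w + t *
      SB.form κ (frame fun i α I => w.1.2 α (I.addOne i)) := by
    intro t
    simp only [pairing_eq, SB.form_frame, Prod.fst_add, Prod.smul_fst, smul_zero, add_zero,
      Prod.snd_add, Prod.smul_snd, map_add, map_smul, smul_eq_mul, mul_add, Finset.sum_add_distrib,
      Finset.mul_sum]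
    simp only [mul_left_comm]
    ring
  have h0 : ∀ i, SB.form (D i).2 (Function.update (fun j => projWC (D j)) i
      (projWC ((0, κ) : WC m n r))) = 0 := by
    intro i
    refine ContinuousAlternatingMap.map_coord_zero _ i ?_
    simp [projWC]
  rw [Omega_snoc, fderiv_localHam_of_vertical hρ hρ0 hL rfl hb, projWC_frame hD] at h1
  rw [projWC_frame hD] at h0
  simp only [h0, Finset.sum_const_zero, map_zero, neg_zero] at h1
  linarith

theorem dynamical_factor (hρ : DifferentiableAt ℝ ρ w.1.1) (hρ0 : ρ w.1.1 ≠ 0)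
    (hL : DifferentiableAt ℝ L w.1) (hD : ∀ i, (D i).1.1 = Pi.single i 1)
    (h : ∀ V : WC m n r, f * ((-1) ^ m * Omega m n r w (Fin.snoc D V : Fin (m + 1) → WC m n r)) =
      -P V.1 - fderiv ℝ (localHam ρ L) w V) : f * ρ w.1.1 = 1 := by
  have := dynamical_momentum hρ hρ0 hL hD h (SB.vol m n r)
  rw [SB.form_vol_frame, SB.form_vol_frame] at this
  field_simp at this
  exact this

theorem dynamical_holonomic (hρ : DifferentiableAt ℝ ρ w.1.1) (hρ0 : ρ w.1.1 ≠ 0)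
    (hL : DifferentiableAt ℝ L w.1) (hD : ∀ i, (D i).1.1 = Pi.single i 1)
    (h : ∀ V : WC m n r, f * ((-1) ^ m * Omega m n r w (Fin.snoc D V : Fin (m + 1) → WC m n r)) =
      -P V.1 - fderiv ℝ (localHam ρ L) w V) (i : Fin m) (α : Fin n) (I : MIdx m r) :
    (D i).1.2 α I.incl = w.1.2 α (I.addOne i) := by
  have h1 := dynamical_momentum hρ hρ0 hL hD h (SB.contact α I i)
  have h2 := dynamical_factor hρ hρ0 hL hD h
  rw [SB.form_contact_frame, SB.form_contact_frame, eq_div_iff hρ0] at h1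
  linear_combination h1 - (D i).1.2 α I.incl * h2

theorem dynamical_tangent
    (h : ∀ V : WC m n r, f * ((-1) ^ m * Omega m n r w (Fin.snoc D V : Fin (m + 1) → WC m n r)) =
      -P V.1 - fderiv ℝ (localHam ρ L) w V) (i : Fin m) :
    P (D i).1 = -fderiv ℝ (localHam ρ L) w (D i) := by
  have h1 := h (D i)
  rw [(Omega m n r w).map_eq_zero_of_eq (Fin.snoc D (D i) : Fin (m + 1) → WC m n r)
    (i := i.castSucc) (j := Fin.last m) (by simp) (Fin.castSucc_lt_last i).ne] at h1
  linarith

theorem sum_vertVec (α : Fin n) (J : MIdx m s) {ι : Type*} [Fintype ι] [DecidableEq (MIdx m s)]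
    (e : ι → MIdx m s) (g : Fin n → ι → ℝ) :
    ∑ β, ∑ I, (vertVec α J : JC m n s).2 β (e I) * g β I = ∑ I, if e I = J then g α I else 0 := by
  rw [Finset.sum_eq_single α]
  · refine Finset.sum_congr rfl fun I _ => ?_
    by_cases hI : e I = J
    · simp [vertVec, hI]
    · simp [vertVec, hI]
  · intro β _ hβ
    simp [vertVec, hβ]
  · simp

/-- The vertical part of the dynamical equation. -/
theorem dynamical_vertical [DecidableEq (MIdx m (r + 1))]
    (hρ : DifferentiableAt ℝ ρ w.1.1) (hρ0 : ρ w.1.1 ≠ 0)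
    (hL : DifferentiableAt ℝ L w.1) (hD : ∀ i, (D i).1.1 = Pi.single i 1)
    (h : ∀ V : WC m n r, f * ((-1) ^ m * Omega m n r w (Fin.snoc D V : Fin (m + 1) → WC m n r)) =
      -P V.1 - fderiv ℝ (localHam ρ L) w V) (α : Fin n) (J : MIdx m (r + 1)) :
    ρ w.1.1 * (fderiv ℝ L w.1 (vertVec α J) - P (vertVec α J)) =
      (∑ i, ∑ I : MIdx m r, if I.incl = J then SB.mom α I i (D i).2 else 0) +
        ∑ i, ∑ I : MIdx m r, if I.addOne i = J then SB.mom α I i w.2 else 0 := by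
  -- Two things see this variation: the projection to `r`-jets, which keeps only `|J| ≤ r`, and the
  -- pairing in H, which involves only `J = I + 1_i`. So for `|J| = r + 1` there is no divergence
  -- term, and for `J = 0` no algebraic one.
  have h1 := h (vertVec α J, 0)
  have h2 := dynamical_factor hρ hρ0 hL hD h
  have hb : ∀ t : ℝ, W.pairing (w + t • ((vertVec α J, 0) : WC m n r)) = W.pairing w + t *
      ∑ i, ∑ I : MIdx m r, if I.addOne i = J then SB.mom α I i w.2 else 0 := by
    intro t
    have hs : ∀ i, (∑ I : MIdx m r, if I.addOne i = J then SB.mom α I i w.2 else 0) =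
        ∑ β, ∑ I : MIdx m r, (vertVec α J : JC m n (r + 1)).2 β (I.addOne i) *
          SB.mom β I i w.2 :=
      fun i => (sum_vertVec α J (fun I => I.addOne i) fun β I => SB.mom β I i w.2).symm
    simp only [hs, pairing_eq, Prod.fst_add, Prod.smul_fst, Prod.snd_add, Prod.smul_snd,
      smul_zero, add_zero, Pi.add_apply, Pi.smul_apply, smul_eq_mul, add_mul,
      Finset.sum_add_distrib, Finset.mul_sum, mul_assoc, add_assoc]
  have h3 : ∀ i, SB.form (D i).2 (Function.update (fun j => projWC (D j)) i
      (projWC ((vertVec α J, 0) : WC m n r))) =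
        ∑ I : MIdx m r, if I.incl = J then SB.mom α I i (D i).2 else 0 := by
    intro i
    rw [projWC_frame hD]
    exact (SB.form_update_frame _ _ _ _).trans (sum_vertVec α J MIdx.incl _)
  rw [Omega_snoc, fderiv_localHam_of_vertical hρ hρ0 hL rfl hb] at h1
  have h4 : SB.form ((vertVec α J, 0) : WC m n r).2 (fun j => projWC (D j)) = 0 := by
    rw [show SB.form ((vertVec α J, 0) : WC m n r).2 = 0 from map_zero _]
    rfl
  simp only [h3, h4, sub_zero] at h1
  field_simp at h1
  linear_combination -h1 + (∑ i, ∑ I : MIdx m r, if I.incl = J then SB.mom α I i (D i).2 else 0) * h2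

end

end

section

variable {m n r s : ℕ}

/-! ### Iterated partial derivatives -/

/-- The iterated partial derivative `∂_{i₁} ⋯ ∂_{i_q} f` along the list `[i₁, …, i_q]`. -/
def listDeriv (l : List (Fin m)) (f : (Fin m → ℝ) → ℝ) : (Fin m → ℝ) → ℝ :=
  l.foldr (fun i g => fun z => fderiv ℝ g z (Pi.single i 1)) f

theorem pderiv_eq_listDeriv (I : Fin m → ℕ) (f : (Fin m → ℝ) → ℝ) :
    pderiv I f = listDeriv (idxList I) f := rfl

theorem listDeriv_cons (i : Fin m) (l : List (Fin m)) (f : (Fin m → ℝ) → ℝ) :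
    listDeriv (i :: l) f = fun z => fderiv ℝ (listDeriv l f) z (Pi.single i 1) := rfl

theorem listDeriv_append (l l' : List (Fin m)) (f : (Fin m → ℝ) → ℝ) :
    listDeriv (l ++ l') f = listDeriv l (listDeriv l' f) := List.foldr_append

variable {f g : (Fin m → ℝ) → ℝ} {z : Fin m → ℝ}

theorem listDeriv_congr (h : f =ᶠ[𝓝 z] g) (l : List (Fin m)) :
    listDeriv l f =ᶠ[𝓝 z] listDeriv l g := by
  induction l with
  | nil => exact h
  | cons i l ih =>
    filter_upwards [ih.fderiv (𝕜 := ℝ)] with y hy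
    simp only [listDeriv_cons, hy]

theorem contDiffAt_fderiv_apply {F : Type*} [NormedAddCommGroup F] [NormedSpace ℝ F] {f : F → ℝ}
    {z : F} (h : ContDiffAt ℝ ∞ f z) (v : F) : ContDiffAt ℝ ∞ (fun y => fderiv ℝ f y v) z :=
  (h.fderiv_right (m := ∞) (by simp)).clm_apply contDiffAt_const

theorem contDiffAt_listDeriv (h : ContDiffAt ℝ ∞ f z) (l : List (Fin m)) :
    ContDiffAt ℝ ∞ (listDeriv l f) z := by
  induction l with
  | nil => exact h
  | cons i l ih => exact contDiffAt_fderiv_apply ih _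

/-- Symmetry of second derivatives, one transposition at a time. Equality is kept on a neighbourhood
so that it can be differentiated again. -/
theorem listDeriv_perm {l l' : List (Fin m)} (hl : l.Perm l')
    (h : ∀ᶠ y in 𝓝 z, ContDiffAt ℝ ∞ f y) : listDeriv l f =ᶠ[𝓝 z] listDeriv l' f := by
  induction hl with
  | nil => rfl
  | cons i _ ih =>
    filter_upwards [ih.fderiv (𝕜 := ℝ)] with y hy
    simp only [listDeriv_cons, hy]
  | swap i j l =>
    filter_upwards [h] with y hy
    have hg := contDiffAt_listDeriv hy l
    have hd : DifferentiableAt ℝ (fderiv ℝ (listDeriv l f)) y :=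
      (hg.fderiv_right (m := ∞) (by simp)).differentiableAt (by simp)
    have e : ∀ v w : Fin m → ℝ, fderiv ℝ (fun x => fderiv ℝ (listDeriv l f) x v) y w =
        fderiv ℝ (fderiv ℝ (listDeriv l f)) y w v := by
      intro v w
      rw [fderiv_clm_apply hd (differentiableAt_const v)]
      simp
    simp only [listDeriv_cons, e]
    exact hg.isSymmSndFDerivAt (by
      rw [minSmoothness_of_isRCLikeNormedField]
      exact WithTop.coe_le_coe.2 (le_top : (2 : ℕ∞) ≤ ⊤)) _ _
  | trans _ _ ih1 ih2 => exact ih1.trans ih2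

theorem listDeriv_zero (l : List (Fin m)) : listDeriv l (fun _ => 0) = fun _ => 0 := by
  induction l with
  | nil => rfl
  | cons i l ih =>
    rw [listDeriv_cons, ih]
    simp

theorem listDeriv_add (hf : ∀ᶠ y in 𝓝 z, ContDiffAt ℝ ∞ f y)
    (hg : ∀ᶠ y in 𝓝 z, ContDiffAt ℝ ∞ g y) (l : List (Fin m)) :
    listDeriv l (fun y => f y + g y) =ᶠ[𝓝 z] fun y => listDeriv l f y + listDeriv l g y := by
  induction l with
  | nil => rfl
  | cons i l ih =>
    filter_upwards [ih.fderiv (𝕜 := ℝ), hf, hg] with y hy hf hg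
    simp only [listDeriv_cons, hy]
    rw [fderiv_fun_add ((contDiffAt_listDeriv hf l).differentiableAt (by simp))
      ((contDiffAt_listDeriv hg l).differentiableAt (by simp))]
    rfl

theorem listDeriv_sum {ι : Type*} (t : Finset ι) {f : ι → (Fin m → ℝ) → ℝ}
    (hf : ∀ a ∈ t, ∀ᶠ y in 𝓝 z, ContDiffAt ℝ ∞ (f a) y) (l : List (Fin m)) :
    listDeriv l (fun y => ∑ a ∈ t, f a y) =ᶠ[𝓝 z] fun y => ∑ a ∈ t, listDeriv l (f a) y := by
  classical
  induction t using Finset.induction_on with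
  | empty => simp [listDeriv_zero]
  | insert a t ha ih =>
    simp only [Finset.sum_insert ha]
    have hs : ∀ᶠ y in 𝓝 z, ContDiffAt ℝ ∞ (fun y => ∑ b ∈ t, f b y) y := by
      have := (Filter.eventually_all_finset t).2
        fun b hb => hf b (Finset.mem_insert_of_mem hb)
      filter_upwards [this] with y hy using ContDiffAt.sum hy
    filter_upwards [listDeriv_add (hf a (Finset.mem_insert_self a t)) hs l,
      ih fun b hb => hf b (Finset.mem_insert_of_mem hb)] with y h1 h2
    rw [h1, h2]

theorem listDeriv_ite (P : Prop) [Decidable P] (l : List (Fin m)) (z : Fin m → ℝ) :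
    listDeriv l (fun y => if P then f y else 0) z = if P then listDeriv l f z else 0 := by
  by_cases h : P
  · simp [h]
  · simp [h, listDeriv_zero]

/-! ### Multi-indices and lists -/

theorem count_idxList (I : Fin m → ℕ) (i : Fin m) : (idxList I).count i = I i := by
  rw [idxList, List.count_flatMap, ← Fin.sum_univ_def]
  simp [List.count_replicate]

theorem sum_count (l : List (Fin m)) : ∑ i, l.count i = l.length := by
  induction l with
  | nil => simp
  | cons a l ih => simp [List.count_cons, Finset.sum_add_distrib, ih]

theorem idxList_addOne_perm (I : MIdx m s) (i : Fin m) :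
    (idxList (I.addOne i).1).Perm (i :: idxList I.1) := by
  rw [List.perm_iff_count]
  intro a
  rw [count_idxList, List.count_cons, count_idxList]
  by_cases h : a = i
  · subst h; simp [MIdx.addOne]
  · simp [MIdx.addOne, h, Ne.symm h]

theorem MIdx.len_incl (I : MIdx m s) : I.incl.len = I.len := rfl

theorem MIdx.len_addOne (I : MIdx m s) (i : Fin m) : (I.addOne i).len = I.len + 1 := by
  simp [MIdx.len, MIdx.addOne, Finset.sum_add_distrib]

/-- A holonomic family of functions consists of the partial derivatives of its lowest member. -/
theorem eventuallyEq_listDeriv_of_holonomic {u : (Fin m → ℝ) → MIdx m (r + 1) → ℝ}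
    (h : ∀ᶠ y in 𝓝 z, ∀ (i : Fin m) (I : MIdx m r),
      fderiv ℝ (fun x => u x I.incl) y (Pi.single i 1) = u y (I.addOne i))
    (l : List (Fin m)) : ∀ J : MIdx m (r + 1), (∀ i, l.count i = J.1 i) →
      (fun y => u y J) =ᶠ[𝓝 z] listDeriv l fun y => u y (MIdx.zero m (r + 1)) := by
  induction l with
  | nil =>
    intro J hJ
    have : J = MIdx.zero m (r + 1) := Subtype.ext (funext fun i => by simpa [MIdx.zero] using (hJ i).symm)
    rw [this]
    rfl
  | cons i l ih =>
    intro J hJ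
    have hlen : l.length ≤ r := by
      have h1 : ∑ i, J.1 i = l.length + 1 := by
        rw [← List.length_cons, ← sum_count (i :: l)]
        exact Finset.sum_congr rfl fun i _ => (hJ i).symm
      have h2 : ∑ i, J.1 i ≤ r + 1 := J.2
      omega
    -- Dropping one index leaves length at most `r`, so the holonomic relation applies to it.
    let I : MIdx m r := ⟨fun j => l.count j, by rw [sum_count]; exact hlen⟩
    have hJI : J = I.addOne i := by
      refine Subtype.ext (funext fun j => ?_)
      rw [← hJ j, List.count_cons]
      by_cases h : j = i
      · subst h; simp [I, MIdx.addOne]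
      · simp [I, MIdx.addOne, h, Ne.symm h]
    filter_upwards [h, (ih I.incl fun _ => rfl).fderiv (𝕜 := ℝ)] with y hy hy'
    rw [hJI, ← hy i I, hy', listDeriv_cons]

/-! ### Total derivatives along prolongations -/

/-- The coordinate expression of the `s`-th lift of a section with components `φ`. -/
def prolong (s : ℕ) (φ : Fin n → (Fin m → ℝ) → ℝ) (z : Fin m → ℝ) : JC m n s :=
  (z, fun α I => listDeriv (idxList I.1) (φ α) z)

variable {φ : Fin n → (Fin m → ℝ) → ℝ}

theorem contDiffAt_prolong (hφ : ∀ α, ContDiffAt ℝ ∞ (φ α) z) :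
    ContDiffAt ℝ ∞ (prolong s φ) z :=
  contDiffAt_id.prodMk
    (contDiffAt_pi.2 fun α => contDiffAt_pi.2 fun _ => contDiffAt_listDeriv (hφ α) _)

theorem fderiv_prolong (hφ : ∀ α, ∀ᶠ y in 𝓝 z, ContDiffAt ℝ ∞ (φ α) y) (i : Fin m) :
    fderiv ℝ (prolong s φ) z (Pi.single i 1) = holLift (prolong (s + 1) φ z) i := by
  have h : HasFDerivAt (prolong s φ) ((ContinuousLinearMap.id ℝ (Fin m → ℝ)).prod
      (ContinuousLinearMap.pi fun α => ContinuousLinearMap.pi fun I : MIdx m s =>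
        fderiv ℝ (listDeriv (idxList I.1) (φ α)) z)) z :=
    (hasFDerivAt_id z).prodMk (hasFDerivAt_pi.2 fun α => hasFDerivAt_pi.2 fun _ =>
      ((contDiffAt_listDeriv (hφ α).self_of_nhds _).differentiableAt (by simp)).hasFDerivAt)
  rw [h.fderiv]
  refine Prod.ext rfl (funext fun α => funext fun I => ?_)
  exact ((listDeriv_perm (idxList_addOne_perm I i) (hφ α)).eq_of_nhds).symm

/-- The chain rule: the holonomic lift is the velocity of the prolonged section. -/
theorem totalDeriv_prolong (hφ : ∀ α, ∀ᶠ y in 𝓝 z, ContDiffAt ℝ ∞ (φ α) y) {G : JC m n s → ℝ}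
    (hG : ContDiffAt ℝ ∞ G (prolong s φ z)) (i : Fin m) :
    totalDeriv i G (prolong (s + 1) φ z) =
      fderiv ℝ (fun y => G (prolong s φ y)) z (Pi.single i 1) := by
  have h1 := (contDiffAt_prolong (s := s) fun α => (hφ α).self_of_nhds).differentiableAt (by simp)
  have h2 := HasFDerivAt.comp (g := G) z (hG.differentiableAt (by simp)).hasFDerivAt
    h1.hasFDerivAt
  rw [show (fun y => G (prolong s φ y)) = G ∘ prolong s φ from rfl, h2.fderiv]
  rw [ContinuousLinearMap.comp_apply, fderiv_prolong hφ]
  rfl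

theorem contDiff_holLift (i : Fin m) :
    ContDiff ℝ ∞ fun z : JC m n (s + 1) => (holLift z i : JC m n s) :=
  contDiff_const.prodMk
    (contDiff_pi.2 fun α => contDiff_pi.2 fun I => contDiff_coeff α (I.addOne i))

theorem contDiffAt_totalDeriv {G : JC m n s → ℝ} {w : JC m n (s + 1)}
    (hG : ContDiffAt ℝ ∞ G (trunc w)) (i : Fin m) : ContDiffAt ℝ ∞ (totalDeriv i G) w := by
  have h := ContDiffAt.comp (g := fderiv ℝ G) (f := (trunc : JC m n (s + 1) →L[ℝ] JC m n s)) w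
    (hG.fderiv_right (m := ∞) (by simp)) trunc.contDiff.contDiffAt
  exact h.clm_apply (contDiff_holLift i).contDiffAt

/-- Smoothness is carried through the induction because each further chain rule needs the previous
total derivative to be differentiable at the nearby prolonged jets. -/
theorem iterTotal_prolong (hφ : ∀ α, ∀ᶠ y in 𝓝 z, ContDiffAt ℝ ∞ (φ α) y) {G : JC m n s → ℝ}
    (hG : ∀ᶠ y in 𝓝 z, ContDiffAt ℝ ∞ G (prolong s φ y)) (l : List (Fin m)) :
    (∀ᶠ y in 𝓝 z, ContDiffAt ℝ ∞ (iterTotal l G) (prolong (s + l.length) φ y)) ∧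
      (fun y => iterTotal l G (prolong (s + l.length) φ y)) =ᶠ[𝓝 z]
        listDeriv l fun y => G (prolong s φ y) := by
  induction l with
  | nil => exact ⟨hG, Filter.EventuallyEq.rfl⟩
  | cons i l ih =>
    have hφ' := Filter.eventually_all.2 fun α => (hφ α).eventually_nhds
    refine ⟨?_, ?_⟩
    · filter_upwards [ih.1] with y hy
      exact contDiffAt_totalDeriv hy i
    · filter_upwards [ih.1, ih.2.fderiv (𝕜 := ℝ), hφ'] with y hy hy' hφy
      simp only [listDeriv_cons]
      rw [← hy']
      exact totalDeriv_prolong hφy hy i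

end

section

variable {m n r s : ℕ}

/-! ### Smoothness of multipliers -/

theorem exists_dual_family {F : Type*} [NormedAddCommGroup F] [NormedSpace ℝ F] {l : ℕ}
    {A : Fin l → F →L[ℝ] ℝ} (h : LinearIndependent ℝ A) :
    ∃ V : Fin l → F, ∀ μ ν, A μ (V ν) = (1 : Matrix (Fin l) (Fin l) ℝ) ν μ := by
  have hs : Function.Surjective (LinearMap.pi fun μ => (A μ).toLinearMap) := by
    rw [← LinearMap.range_eq_top]
    by_contra hne
    -- A nonzero functional vanishing on the image would be a linear relation among the `A μ`.
    obtain ⟨g, hg0, hg⟩ := Submodule.exists_le_ker_of_lt_top _ (lt_top_iff_ne_top.2 hne)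
    have hc : ∀ μ, g (Pi.single μ 1) = 0 := by
      refine Fintype.linearIndependent_iff.1 h (fun μ => g (Pi.single μ 1)) ?_
      ext v
      have h1 : g ((LinearMap.pi fun μ => (A μ).toLinearMap) v) = 0 := hg ⟨v, rfl⟩
      rw [LinearMap.pi_apply_eq_sum_univ g] at h1
      have h2 : ∀ μ, (Pi.single μ 1 : Fin l → ℝ) = fun ν => if μ = ν then 1 else 0 := by
        intro μ
        funext ν
        simp [Pi.single_apply, eq_comm]
      simpa [mul_comm, h2] using h1
    refine hg0 (LinearMap.pi_ext' fun μ => LinearMap.ext_ring ?_)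
    simpa using hc μ
  choose V hV using fun ν => hs ((1 : Matrix (Fin l) (Fin l) ℝ) ν)
  exact ⟨V, fun μ ν => congrFun (hV ν) μ⟩

theorem contDiffAt_matrix_det {E : Type*} [NormedAddCommGroup E] [NormedSpace ℝ E] {l : ℕ}
    {M : E → Matrix (Fin l) (Fin l) ℝ} {z : E} (h : ∀ i j, ContDiffAt ℝ ∞ (fun y => M y i j) z) :
    ContDiffAt ℝ ∞ (fun y => (M y).det) z := by
  simp only [Matrix.det_apply, Units.smul_def, zsmul_eq_mul]
  exact ContDiffAt.sum fun τ _ => contDiffAt_const.mul (contDiffAt_prod fun i _ => h _ _)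

/-- The coefficients of a smooth combination of independent smooth covectors are smooth. -/
theorem contDiffAt_multiplier {E F : Type*} [NormedAddCommGroup E] [NormedSpace ℝ E]
    [NormedAddCommGroup F] [NormedSpace ℝ F] {l : ℕ} {A : Fin l → E → F →L[ℝ] ℝ}
    {lam : E → Fin l → ℝ} {z : E} (hA : ∀ μ v, ContDiffAt ℝ ∞ (fun y => A μ y v) z)
    (hind : LinearIndependent ℝ fun μ => A μ z)
    (hg : ∀ v, ContDiffAt ℝ ∞ (fun y => ∑ μ, lam y μ * A μ y v) z) : ContDiffAt ℝ ∞ lam z := by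
  -- Test vectors dual to the covectors at `z` are kept fixed as `y` varies: the matrix is the
  -- identity at `z`, so its determinant stays nonzero nearby.
  obtain ⟨V, hV⟩ := exists_dual_family hind
  let M : E → Matrix (Fin l) (Fin l) ℝ := fun y => Matrix.of fun ν μ => A μ y (V ν)
  let b : E → Fin l → ℝ := fun y ν => ∑ μ, lam y μ * A μ y (V ν)
  have hM : ∀ ν μ, ContDiffAt ℝ ∞ (fun y => M y ν μ) z := fun ν μ => hA μ (V ν)
  have hdet := contDiffAt_matrix_det hM
  have hdet0 : (M z).det ≠ 0 := by
    have : M z = 1 := by ext ν μ; exact hV μ ν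
    simp [this]
  have hb : ∀ y, b y = (M y).mulVec (lam y) := by
    intro y
    funext ν
    simp [b, M, Matrix.mulVec, dotProduct, mul_comm]
  have hcr : ∀ y, (M y).cramer (b y) = (M y).det • lam y := by
    intro y
    rw [hb, Matrix.cramer_eq_adjugate_mulVec, Matrix.mulVec_mulVec, Matrix.adjugate_mul,
      Matrix.smul_mulVec, Matrix.one_mulVec]
  refine contDiffAt_pi.2 fun μ => ?_
  have hnum : ContDiffAt ℝ ∞ (fun y => ((M y).updateCol μ (b y)).det) z := by
    refine contDiffAt_matrix_det fun i j => ?_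
    simp only [Matrix.updateCol_apply]
    by_cases hj : j = μ
    · simpa [hj] using hg (V i)
    · simpa [hj] using hM i j
  refine (hnum.div hdet hdet0).congr_of_eventuallyEq ?_
  filter_upwards [hdet.continuousAt.eventually_ne hdet0] with y hy
  rw [Pi.div_apply, ← Matrix.cramer_apply, hcr, Pi.smul_apply, smul_eq_mul, mul_div_cancel_left₀ _ hy]

/-! ### Solutions in coordinates -/

/-- A section `s` of `W` in coordinates, smooth near `z`, whose tangent space at `z` satisfies the
dynamical equation with constraint covector `P`. -/
structure LocalSolution (ρ : (Fin m → ℝ) → ℝ) (L : JC m n (r + 1) → ℝ)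
    (s : (Fin m → ℝ) → WC m n r) (P : JC m n (r + 1) →L[ℝ] ℝ) (z : Fin m → ℝ) : Prop where
  smooth : ContDiffAt ℝ ∞ s z
  fst_eq : ∀ᶠ y in 𝓝 z, (s y).1.1 = y
  density_smooth : ContDiffAt ℝ ∞ ρ z
  density_ne : ρ z ≠ 0
  lagrangian_smooth : ContDiffAt ℝ ∞ L (s z).1
  equation : ∃ f : ℝ, ∀ V : WC m n r, f * ((-1) ^ m * Omega m n r (s z)
    (Fin.snoc (fun i => fderiv ℝ s z (Pi.single i 1)) V : Fin (m + 1) → WC m n r)) =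
      -P V.1 - fderiv ℝ (localHam ρ L) (s z) V

namespace LocalSolution

variable {ρ : (Fin m → ℝ) → ℝ} {L : JC m n (r + 1) → ℝ} {s : (Fin m → ℝ) → WC m n r}
  {P : JC m n (r + 1) →L[ℝ] ℝ} {z : Fin m → ℝ}

theorem fderiv_fst_fst (h : LocalSolution ρ L s P z) (i : Fin m) :
    (fderiv ℝ s z (Pi.single i 1)).1.1 = Pi.single i 1 := by
  have h1 : HasFDerivAt (fun y => (s y).1.1) _ z :=
    ((h.smooth.differentiableAt (by simp)).hasFDerivAt.fst).fst
  have h2 : HasFDerivAt (fun y => (s y).1.1) (ContinuousLinearMap.id ℝ (Fin m → ℝ)) z :=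
    (hasFDerivAt_id z).congr_of_eventuallyEq h.fst_eq
  exact DFunLike.congr_fun (h1.unique h2) (Pi.single i 1)

theorem density_smooth' (h : LocalSolution ρ L s P z) : ContDiffAt ℝ ∞ ρ (s z).1.1 := by
  rw [h.fst_eq.self_of_nhds]; exact h.density_smooth

theorem density_ne' (h : LocalSolution ρ L s P z) : ρ (s z).1.1 ≠ 0 := by
  rw [h.fst_eq.self_of_nhds]; exact h.density_ne

theorem fderiv_coeff (h : LocalSolution ρ L s P z) (α : Fin n) (J : MIdx m (r + 1))
    (i : Fin m) : fderiv ℝ (fun y => (s y).1.2 α J) z (Pi.single i 1) =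
      (fderiv ℝ s z (Pi.single i 1)).1.2 α J := by
  have h1 := ((h.smooth.differentiableAt (by simp)).hasFDerivAt.fst).snd
  have h2 := hasFDerivAt_pi'.1 (hasFDerivAt_pi'.1 h1 α) J
  rw [h2.fderiv]
  rfl

theorem fderiv_mom (h : LocalSolution ρ L s P z) (α : Fin n) (I : MIdx m r) (i j : Fin m) :
    fderiv ℝ (fun y => SB.mom α I i (s y).2) z (Pi.single j 1) =
      SB.mom α I i (fderiv ℝ s z (Pi.single j 1)).2 := by
  have h1 := (SB.mom α I i).hasFDerivAt.comp z
    ((h.smooth.differentiableAt (by simp)).hasFDerivAt.snd)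
  rw [show (fun y => SB.mom α I i (s y).2) = SB.mom α I i ∘ fun y => (s y).2 from rfl, h1.fderiv]
  rfl

theorem holonomic (h : LocalSolution ρ L s P z) (α : Fin n) (i : Fin m) (I : MIdx m r) :
    fderiv ℝ (fun y => (s y).1.2 α I.incl) z (Pi.single i 1) = (s z).1.2 α (I.addOne i) := by
  obtain ⟨f, hf⟩ := h.equation
  rw [h.fderiv_coeff]
  exact dynamical_holonomic (h.density_smooth'.differentiableAt (by simp)) h.density_ne'
    (h.lagrangian_smooth.differentiableAt (by simp)) h.fderiv_fst_fst hf i α I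

theorem tangent (h : LocalSolution ρ L s P z) (i : Fin m) :
    P (fderiv ℝ s z (Pi.single i 1)).1 =
      -fderiv ℝ (localHam ρ L) (s z) (fderiv ℝ s z (Pi.single i 1)) := by
  obtain ⟨f, hf⟩ := h.equation
  exact dynamical_tangent hf i

theorem vertical [DecidableEq (MIdx m (r + 1))] (h : LocalSolution ρ L s P z) (α : Fin n)
    (J : MIdx m (r + 1)) :
    ρ z * (fderiv ℝ L (s z).1 (vertVec α J) - P (vertVec α J)) =
      (∑ x : Fin m × MIdx m r, if x.2.incl = J then
        fderiv ℝ (fun y => SB.mom α x.2 x.1 (s y).2) z (Pi.single x.1 1) else 0) +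
        ∑ x : Fin m × MIdx m r, if x.2.addOne x.1 = J then SB.mom α x.2 x.1 (s z).2 else 0 := by
  obtain ⟨f, hf⟩ := h.equation
  have := dynamical_vertical (h.density_smooth'.differentiableAt (by simp)) h.density_ne'
    (h.lagrangian_smooth.differentiableAt (by simp)) h.fderiv_fst_fst hf α J
  rw [h.fst_eq.self_of_nhds] at this
  simp only [h.fderiv_mom, Fintype.sum_prod_type]
  exact this

theorem contDiffAt_mom (h : LocalSolution ρ L s P z) (α : Fin n) (I : MIdx m r) (i : Fin m) :
    ContDiffAt ℝ ∞ (fun y => SB.mom α I i (s y).2) z :=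
  (SB.mom α I i).contDiff.contDiffAt.comp z h.smooth.snd

/-- The constraint covectors along a solution vary smoothly. -/
theorem contDiffAt_covector {P : (Fin m → ℝ) → JC m n (r + 1) →L[ℝ] ℝ}
    (h : ∀ᶠ y in 𝓝 z, LocalSolution ρ L s (P y) y) (v : JC m n (r + 1)) :
    ContDiffAt ℝ ∞ (fun y => P y v) z := by
  classical
  have h0 := h.self_of_nhds
  have hD : ∀ i : Fin m, ContDiffAt ℝ ∞ (fun y => fderiv ℝ s y (Pi.single i 1)) z := fun i =>
    (h0.smooth.fderiv_right (m := ∞) (by simp)).clm_apply contDiffAt_const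
  -- Independence is assumed for the full differentials of the constraints, so vertical components
  -- alone need not determine the multipliers; the tangential ones are supplied by −dH.
  have hT : ∀ i : Fin m, ContDiffAt ℝ ∞ (fun y => P y (fderiv ℝ s y (Pi.single i 1)).1) z := by
    intro i
    have h1 := ContDiffAt.comp (g := fderiv ℝ (localHam ρ L)) z
      ((contDiffAt_localHam h0.density_smooth' h0.density_ne' h0.lagrangian_smooth).fderiv_right
        (m := ∞) (by simp)) h0.smooth
    refine (h1.clm_apply (hD i)).neg.congr_of_eventuallyEq ?_
    filter_upwards [h] with y hy using hy.tangent i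
  have hV : ∀ α J, ContDiffAt ℝ ∞ (fun y => P y (vertVec α J)) z := by
    intro α J
    have h1 : ContDiffAt ℝ ∞ (fun y => fderiv ℝ L (s y).1 (vertVec α J)) z :=
      (ContDiffAt.comp (g := fderiv ℝ L) z
        (h0.lagrangian_smooth.fderiv_right (m := ∞) (by simp)) h0.smooth.fst).clm_apply
          contDiffAt_const
    have h2 : ContDiffAt ℝ ∞ (fun y =>
        (∑ x : Fin m × MIdx m r, if x.2.incl = J then
          fderiv ℝ (fun y => SB.mom α x.2 x.1 (s y).2) y (Pi.single x.1 1) else 0) +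
        ∑ x : Fin m × MIdx m r, if x.2.addOne x.1 = J then SB.mom α x.2 x.1 (s y).2 else 0) z := by
      refine ContDiffAt.add (ContDiffAt.sum fun x _ => ?_) (ContDiffAt.sum fun x _ => ?_)
      · split_ifs
        · exact contDiffAt_fderiv_apply (h0.contDiffAt_mom _ _ _) _
        · exact contDiffAt_const
      · split_ifs
        · exact h0.contDiffAt_mom _ _ _
        · exact contDiffAt_const
    refine (h1.sub (h2.div h0.density_smooth h0.density_ne)).congr_of_eventuallyEq ?_
    filter_upwards [h] with y hy
    simp only [Pi.div_apply]
    rw [← hy.vertical α J, mul_div_cancel_left₀ _ hy.density_ne]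
    ring
  have hv : ∀ᶠ y in 𝓝 z, P y v = (∑ i, v.1 i * P y (fderiv ℝ s y (Pi.single i 1)).1) +
      ∑ α, ∑ J, (v.2 α J - ∑ i, v.1 i * (fderiv ℝ s y (Pi.single i 1)).1.2 α J) *
        P y (vertVec α J) := by
    filter_upwards [h] with y hy
    -- The tangent vectors of the section, normalised over the base, and the vertical coordinate
    -- vectors form a basis moving smoothly with `y`.
    have e : v = (∑ i, v.1 i • (fderiv ℝ s y (Pi.single i 1)).1) +
        ∑ α, ∑ J, (v.2 α J - ∑ i, v.1 i * (fderiv ℝ s y (Pi.single i 1)).1.2 α J) •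
          vertVec α J := by
      rw [← vertical_eq_sum fun α J =>
        v.2 α J - ∑ i, v.1 i * (fderiv ℝ s y (Pi.single i 1)).1.2 α J]
      ext a b
      · simp [Prod.fst_sum, hy.fderiv_fst_fst, Pi.single_apply]
      · simp [Prod.snd_sum]
    conv_lhs => rw [e]
    simp only [map_add, map_sum, map_smul, smul_eq_mul]
  refine ContDiffAt.congr_of_eventuallyEq ?_ hv
  refine ContDiffAt.add (ContDiffAt.sum fun i _ => contDiffAt_const.mul (hT i))
    (ContDiffAt.sum fun α _ => ContDiffAt.sum fun J _ => ContDiffAt.mul ?_ (hV α J))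
  refine contDiffAt_const.sub (ContDiffAt.sum fun i _ => contDiffAt_const.mul ?_)
  exact (contDiff_coeff α J).contDiffAt.comp z (hD i).fst

end LocalSolution

/-! ### The Euler–Lagrange equations in coordinates -/

/-- The function indexed by `(i, I)` enters once for `J = I`, as (-1)^{|I|} ∂_I ∂_i p, and once for
`J = I + 1_i`, with one more sign and the same derivative up to order. -/
theorem sum_listDeriv_divergence [DecidableEq (MIdx m (r + 1))]
    {A : MIdx m (r + 1) → (Fin m → ℝ) → ℝ} {p : Fin m × MIdx m r → (Fin m → ℝ) → ℝ}
    {z : Fin m → ℝ} (hp : ∀ x, ∀ᶠ y in 𝓝 z, ContDiffAt ℝ ∞ (p x) y)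
    (hA : ∀ J, A J =ᶠ[𝓝 z] fun y =>
      (∑ x, if x.2.incl = J then fderiv ℝ (p x) y (Pi.single x.1 1) else 0) +
        ∑ x, if x.2.addOne x.1 = J then p x y else 0) :
    ∑ J : MIdx m (r + 1), (-1 : ℝ) ^ J.len * listDeriv (idxList J.1) (A J) z = 0 := by
  have h1 : ∀ J : MIdx m (r + 1), listDeriv (idxList J.1) (A J) z =
      (∑ x, if x.2.incl = J then listDeriv (x.1 :: idxList J.1) (p x) z else 0) +
        ∑ x, if x.2.addOne x.1 = J then listDeriv (idxList J.1) (p x) z else 0 := by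
    intro J
    have s1 : ∀ x : Fin m × MIdx m r, ∀ᶠ y in 𝓝 z, ContDiffAt ℝ ∞
        (fun y => if x.2.incl = J then listDeriv [x.1] (p x) y else 0) y := by
      intro x
      filter_upwards [hp x] with y hy
      split_ifs
      · exact contDiffAt_listDeriv hy [x.1]
      · exact contDiffAt_const
    have s2 : ∀ x : Fin m × MIdx m r, ∀ᶠ y in 𝓝 z, ContDiffAt ℝ ∞
        (fun y => if x.2.addOne x.1 = J then p x y else 0) y := by
      intro x
      filter_upwards [hp x] with y hy
      split_ifs
      · exact hy
      · exact contDiffAt_const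
    rw [(listDeriv_congr (hA J) _).eq_of_nhds]
    refine (listDeriv_add (f := fun y => ∑ x, if x.2.incl = J then listDeriv [x.1] (p x) y else 0)
      ?_ ?_ _).eq_of_nhds.trans ?_
    · filter_upwards [Filter.eventually_all.2 s1] with y hy using ContDiffAt.sum fun x _ => hy x
    · filter_upwards [Filter.eventually_all.2 s2] with y hy using ContDiffAt.sum fun x _ => hy x
    rw [(listDeriv_sum _ (fun x _ => s1 x) _).eq_of_nhds,
      (listDeriv_sum _ (fun x _ => s2 x) _).eq_of_nhds]
    simp only [listDeriv_ite, ← listDeriv_append]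
    congr 1
    refine Finset.sum_congr rfl fun x _ => ?_
    rw [(listDeriv_perm (List.perm_append_singleton x.1 (idxList J.1)) (hp x)).eq_of_nhds]
  simp only [h1, mul_add, Finset.mul_sum, Finset.sum_add_distrib, mul_ite, mul_zero]
  rw [Finset.sum_comm, Finset.sum_comm (γ := MIdx m (r + 1)), ← Finset.sum_add_distrib]
  refine Finset.sum_eq_zero fun x _ => ?_
  rw [Finset.sum_ite_eq, Finset.sum_ite_eq, if_pos (Finset.mem_univ _),
    if_pos (Finset.mem_univ _), MIdx.len_incl, MIdx.len_addOne,
    (listDeriv_perm (idxList_addOne_perm x.2 x.1) (hp x)).eq_of_nhds]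
  change (-1 : ℝ) ^ x.2.len * listDeriv (x.1 :: idxList x.2.1) (p x) z + _ = 0
  ring

/-- No regularity of `P` is needed here: the differentiated combination coincides with an expression
in the smooth momenta. -/
theorem LocalSolution.eulerLagrange {ρ : (Fin m → ℝ) → ℝ} {L : JC m n (r + 1) → ℝ}
    {s : (Fin m → ℝ) → WC m n r} {z : Fin m → ℝ} {P : (Fin m → ℝ) → JC m n (r + 1) →L[ℝ] ℝ}
    (h : ∀ᶠ y in 𝓝 z, LocalSolution ρ L s (P y) y) (α : Fin n) :
    ∑ J : MIdx m (r + 1), (-1 : ℝ) ^ J.len * listDeriv (idxList J.1) (fun y =>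
      ρ y * (fderiv ℝ L (s y).1 (vertVec α J) - P y (vertVec α J))) z = 0 := by
  classical
  refine sum_listDeriv_divergence (p := fun x y => SB.mom α x.2 x.1 (s y).2) (fun x => ?_)
    fun J => ?_
  · filter_upwards [h] with y hy using hy.contDiffAt_mom _ _ _
  · filter_upwards [h] with y hy using hy.vertical α J

end

section

variable {m n r s l : ℕ} {M E : Type*}
  [TopologicalSpace M] [ChartedSpace (EuclideanSpace ℝ (Fin m)) M]
  [TopologicalSpace E] [ChartedSpace (EuclideanSpace ℝ (Fin (m + n))) E]
  {π : FibredManifold m n M E}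

/-! ### Jets and their coordinates -/

namespace Jet

theorem val_eq (j : Jet π s) : j.val = (Quotient.out j.cls).1 j.pt := by
  obtain ⟨x, q⟩ := j
  conv_lhs => rw [← Quotient.out_eq q]
  rfl

theorem proj_val (j : Jet π s) : π.proj j.val = j.pt := by
  rw [val_eq]
  obtain ⟨U, -, hx, -, h⟩ := (Quotient.out j.cls).2
  exact h _ hx

theorem pt_mem_base {c : π.Chart} {j : Jet π s} (h : j ∈ dom s c) : j.pt ∈ c.base.source := by
  rw [← proj_val]; exact c.mem_base _ h

theorem coord_zero {c : π.Chart} {j : Jet π s} (h : j ∈ dom s c) (α : Fin n) :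
    (coord c j).2 α (MIdx.zero m s) = (c.total j.val).2 α := by
  have e : idxList (MIdx.zero m s).1 = [] := by simp [idxList, MIdx.zero]
  simp only [coord, pderiv_eq_listDeriv, e]
  change localExpr c _ α (c.base j.pt) = _
  rw [localExpr, c.base.left_inv (pt_mem_base h), val_eq]

/-- `Jet.coord` is computed from a chosen representative; `s`-equivalence makes the choice
immaterial. -/
theorem coord_mk {c : π.Chart} {x : M} (φ : {φ : M → E // IsLocalSection π x φ})
    (h : φ.1 x ∈ c.total.source) :
    coord c (⟨x, Quotient.mk _ φ⟩ : Jet π s) =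
      (c.base x, fun α I => pderiv I.1 (localExpr c φ.1 α) (c.base x)) := by
  have h1 := Quotient.mk_out (s := jetSetoid π s x) φ
  refine Prod.ext rfl (funext fun α => funext fun I => ?_)
  exact h1.2 c (by rw [h1.1]; exact h) α I

theorem eq_mk {j : Jet π s} {x : M} (hx : j.pt = x) (φ : {φ : M → E // IsLocalSection π x φ})
    (hv : j.val = φ.1 x)
    (h : ∀ c : π.Chart, j ∈ dom s c → ∀ α (I : MIdx m s),
      (coord c j).2 α I = pderiv I.1 (localExpr c φ.1 α) (c.base x)) :
    j = ⟨x, Quotient.mk _ φ⟩ := by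
  subst hx
  have h0 : (Quotient.out j.cls).1 j.pt = φ.1 j.pt := by rw [← val_eq]; exact hv
  have h1 : j.cls = Quotient.mk _ φ := by
    rw [← Quotient.out_eq j.cls]
    refine Quotient.sound ⟨h0, fun c hc α I => ?_⟩
    exact h c (by change j.val ∈ c.total.source; rw [val_eq]; exact hc) α I
  obtain ⟨x, q⟩ := j
  exact congrArg (Jet.mk x) h1

theorem coord_jetLift {φ : M → E} (hφ : IsSection π φ) {c : π.Chart} {x : M}
    (h : φ x ∈ c.total.source) :
    coord c (jetLift s hφ x) = prolong s (localExpr c φ) (c.base x) :=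
  coord_mk ⟨φ, hφ.isLocalSection x⟩ h

end Jet

/-! ### Sections of `W` in coordinates -/

theorem contract_smul {V : Type*} [NormedAddCommGroup V] [NormedSpace ℝ V]
    (Ω : V [⋀^Fin (m + 1)]→L[ℝ] ℝ) (f : ℝ) (X : ⋀[ℝ]^m V) (v : V) :
    contract Ω (f • X) v = f * contract Ω X v := by
  simp only [contract, map_smul, smul_eq_mul]
  ring

namespace W

variable {σ : M → W π r} {c : π.Chart} {x : M}

theorem IsSection.mem_base (hσ : W.IsSection σ) (hx : σ x ∈ dom c) : x ∈ c.base.source := by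
  have := Jet.pt_mem_base (j := (σ x).jet) hx
  rwa [hσ.1] at this

theorem secExpr_base (hσ : W.IsSection σ) (hx : σ x ∈ dom c) :
    secExpr c σ (c.base x) = coord c (σ x) := by
  rw [secExpr, c.base.left_inv (hσ.mem_base hx)]

theorem eventually_chart (hσ : W.IsSection σ) (hx : σ x ∈ dom c) :
    ∀ᶠ y in 𝓝 (c.base x), y ∈ c.base.target ∧ σ (c.base.symm y) ∈ dom c ∧
      ContDiffAt ℝ ∞ (secExpr c σ) y := by
  filter_upwards [hσ.2 c x hx,
    c.base.open_target.mem_nhds (c.base.map_source (hσ.mem_base hx))] with y h1 h2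
  exact ⟨h2, h1⟩

theorem contDiffAt_secExpr (hσ : W.IsSection σ) (hx : σ x ∈ dom c) :
    ContDiffAt ℝ ∞ (secExpr c σ) (c.base x) :=
  (eventually_chart hσ hx).self_of_nhds.2.2

theorem secExpr_fst_fst (hσ : W.IsSection σ) {y : Fin m → ℝ} (hy : y ∈ c.base.target) :
    (secExpr c σ y).1.1 = y := by
  change c.base (σ (c.base.symm y)).jet.pt = y
  rw [hσ.1, c.base.right_inv hy]

/-- The underlying section of `π`. -/
def underlying (σ : M → W π r) (x : M) : E := (σ x).jet.val

theorem eventually_of_chart (hσ : W.IsSection σ) (hx : σ x ∈ dom c) {p : M → Prop}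
    (h : ∀ᶠ y in 𝓝 (c.base x), p (c.base.symm y)) : ∀ᶠ x' in 𝓝 x, p x' := by
  have hb := hσ.mem_base hx
  filter_upwards [(c.base.continuousAt hb).eventually h, c.base.open_source.mem_nhds hb]
    with x' h1 h2
  rwa [c.base.left_inv h2] at h1

theorem localExpr_underlying (hσ : W.IsSection σ) (hx : σ x ∈ dom c) (α : Fin n) :
    localExpr c (underlying σ) α =ᶠ[𝓝 (c.base x)]
      fun y => (secExpr c σ y).1.2 α (MIdx.zero m (r + 1)) := by
  filter_upwards [eventually_chart hσ hx] with y hy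
  exact (Jet.coord_zero hy.2.1 α).symm

theorem contDiffAt_localExpr_underlying (hσ : W.IsSection σ) (hx : σ x ∈ dom c) :
    ∀ᶠ y in 𝓝 (c.base x), ∀ α, ContDiffAt ℝ ∞ (localExpr c (underlying σ) α) y := by
  have h1 := Filter.eventually_all.2 fun α =>
    (localExpr_underlying hσ hx α).eventually_nhds
  filter_upwards [h1, eventually_chart hσ hx] with y h2 h3 α
  exact ((contDiff_coeff α _).contDiffAt.comp y h3.2.2.fst).congr_of_eventuallyEq (h2 α)

theorem isSection_underlying (hσ : W.IsSection σ) : FieldTheory.IsSection π (underlying σ) := by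
  refine ⟨fun x => ?_, fun x => (Jet.proj_val _).trans (hσ.1 x)⟩
  obtain ⟨c, hx⟩ := π.exists_chart (underlying σ x)
  replace hx : σ x ∈ dom c := hx
  have hb := hσ.mem_base hx
  let g : (Fin m → ℝ) → (Fin m → ℝ) × (Fin n → ℝ) :=
    fun y => (y, fun α => localExpr c (underlying σ) α y)
  have hg : ContDiffAt ℝ ∞ g (c.base x) := contDiffAt_id.prodMk
    (contDiffAt_pi.2 (contDiffAt_localExpr_underlying hσ hx).self_of_nhds)
  -- `g` is the chart expression of the section, so near `x` the section is `c.total.symm ∘ g ∘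
  -- c.base`, a composite of smooth maps.
  have hgt : ∀ x', σ x' ∈ dom c → g (c.base x') = c.total (underlying σ x') := by
    intro x' hx'
    refine Prod.ext ?_ (funext fun α => ?_)
    · exact ((c.fst_eq _ hx').trans (congrArg c.base
        ((Jet.proj_val _).trans (hσ.1 x')))).symm
    · simp only [g, localExpr]
      rw [c.base.left_inv (hσ.mem_base hx')]
  have h1 : ContMDiffAt (𝓡 m) 𝓘(ℝ, (Fin m → ℝ) × (Fin n → ℝ)) ∞ (g ∘ c.base) x :=
    hg.contMDiffAt.comp x (c.base_smooth.1.contMDiffAt (c.base.open_source.mem_nhds hb))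
  have h2 : ContMDiffAt 𝓘(ℝ, (Fin m → ℝ) × (Fin n → ℝ)) (𝓡 (m + n)) ∞ c.total.symm
      ((g ∘ c.base) x) := by
    refine c.total_symm_smooth.contMDiffAt (c.total.open_target.mem_nhds ?_)
    rw [Function.comp_apply, hgt x hx]
    exact c.total.map_source hx
  refine (h2.comp x h1).congr_of_eventuallyEq ?_
  filter_upwards [eventually_of_chart hσ hx (p := fun x' => σ x' ∈ dom c)
    ((eventually_chart hσ hx).mono fun y hy => hy.2.1)] with x' hx'
  rw [Function.comp_apply, Function.comp_apply, hgt x' hx']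
  exact (c.total.left_inv hx').symm

variable {η : VolumeForm m M} {L : Jet π (r + 1) → ℝ} {C : Set (Jet π (r + 1))}

/-- The combination `λ_μ dΨ^μ` along a section in coordinates. -/
def covector (c : π.Chart) (Ψ : Fin l → Jet π (r + 1) → ℝ) (lam : W π r → Fin l → ℝ)
    (σ : M → W π r) (y : Fin m → ℝ) : JC m n (r + 1) →L[ℝ] ℝ :=
  ∑ μ, lam (σ (c.base.symm y)) μ • fderiv ℝ (Jet.rep c (Ψ μ)) (secExpr c σ y).1

theorem covector_apply (c : π.Chart) (Ψ : Fin l → Jet π (r + 1) → ℝ) (lam : W π r → Fin l → ℝ)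
    (σ : M → W π r) (y : Fin m → ℝ) (v : JC m n (r + 1)) :
    covector c Ψ lam σ y v = ∑ μ, lam (σ (c.base.symm y)) μ *
      fderiv ℝ (Jet.rep c (Ψ μ)) (secExpr c σ y).1 v := by
  simp [covector]

theorem eventually_mem (hσ : W.IsSection σ) (hx : σ x ∈ dom c) {U : Set (Jet π (r + 1))}
    (hU : IsOpen U) (hxU : (σ x).jet ∈ U) :
    ∀ᶠ y in 𝓝 (c.base x), (σ (c.base.symm y)).jet ∈ U := by
  have h1 : ContinuousAt (fun y => (secExpr c σ y).1) (c.base x) :=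
    (contDiffAt_secExpr hσ hx).continuousAt.fst
  have h2 := hU (σ x).jet hxU c hx
  have h3 : (fun y => (secExpr c σ y).1) (c.base x) = Jet.coord c (σ x).jet := by
    simp only [secExpr_base hσ hx, coord]
  rw [← h3] at h2
  filter_upwards [h1.eventually h2, eventually_chart hσ hx] with y hy hy'
  exact hy _ hy'.2.1 rfl

/-! ### Integral sections as local solutions -/

variable {X : ∀ w : W π r, MultiVector w} {Q : LocalConstraint C l} {lam : W π r → Fin l → ℝ}

theorem localSolution (hL : Jet.SmoothOn L Set.univ)
    (hX : ∀ x, (σ x).jet ∈ Q.U → DynamicalEq η L Q.Ψ (lam (σ x)) (X (σ x)))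
    (hσ : IsIntegralSection X σ) (hx : σ x ∈ dom c) (hxU : (σ x).jet ∈ Q.U) :
    LocalSolution (density η.form c.base) (Jet.rep c L) (secExpr c σ)
      (covector c Q.Ψ lam σ (c.base x)) (c.base x) := by
  have hb := hσ.1.mem_base hx
  have ht := c.base.map_source hb
  have hs := secExpr_base hσ.1 hx
  refine ⟨contDiffAt_secExpr hσ.1 hx, ?_, ?_, η.ne_zero _ c.base_smooth _ ht, ?_, ?_⟩
  · filter_upwards [c.base.open_target.mem_nhds ht] with y hy using secExpr_fst_fst hσ.1 hy
  · exact (η.smooth _ c.base_smooth).contDiffAt (c.base.open_target.mem_nhds ht)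
  · rw [hs]
    exact hL _ (Set.mem_univ _) c hx
  · obtain ⟨f, -, hf⟩ := hσ.2 x c hx
    -- The factor `f` relates the given `m`-vector to the wedge of the coordinate tangent vectors;
    -- it is determined only afterwards, by `dynamical_factor`.
    refine ⟨f, fun V => ?_⟩
    have h1 := hX x hxU c hx V
    rw [hf, contract_smul, contract_ιMulti] at h1
    have h2 : ∀ μ, fderiv ℝ (fun z : WC m n r => Jet.rep c (Q.Ψ μ) z.1) (coord c (σ x)) V =
        fderiv ℝ (Jet.rep c (Q.Ψ μ)) (coord c (σ x)).1 V.1 := by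
      intro μ
      have h3 : HasFDerivAt (fun z : WC m n r => Jet.rep c (Q.Ψ μ) z.1) _ (coord c (σ x)) :=
        HasFDerivAt.comp (g := Jet.rep c (Q.Ψ μ)) (coord c (σ x))
          ((Q.smooth μ _ hxU c hx).differentiableAt (by simp)).hasFDerivAt hasFDerivAt_fst
      rw [h3.fderiv]
      rfl
    rw [covector_apply, hs, c.base.left_inv hb]
    simp only [h2] at h1
    rw [mul_left_comm]
    exact h1

theorem eventually_localSolution (hL : Jet.SmoothOn L Set.univ)
    (hX : ∀ x, (σ x).jet ∈ Q.U → DynamicalEq η L Q.Ψ (lam (σ x)) (X (σ x)))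
    (hσ : IsIntegralSection X σ) (hx : σ x ∈ dom c) (hxU : (σ x).jet ∈ Q.U) :
    ∀ᶠ y in 𝓝 (c.base x), LocalSolution (density η.form c.base) (Jet.rep c L) (secExpr c σ)
      (covector c Q.Ψ lam σ y) y := by
  filter_upwards [eventually_chart hσ.1 hx, eventually_mem hσ.1 hx Q.isOpen_U hxU] with y h1 h2
  have := localSolution hL hX hσ h1.2.1 h2
  rwa [c.base.right_inv h1.1] at this

/-- Integral sections are holonomic. -/
theorem secExpr_eq_prolong (hL : Jet.SmoothOn L Set.univ)
    (hX : ∀ x, (σ x).jet ∈ Q.U → DynamicalEq η L Q.Ψ (lam (σ x)) (X (σ x)))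
    (hσ : IsIntegralSection X σ) (hx : σ x ∈ dom c) (hxU : (σ x).jet ∈ Q.U) :
    ∀ᶠ y in 𝓝 (c.base x),
      (secExpr c σ y).1 = prolong (r + 1) (localExpr c (underlying σ)) y := by
  have h1 : ∀ α (J : MIdx m (r + 1)), (fun y => (secExpr c σ y).1.2 α J) =ᶠ[𝓝 (c.base x)]
      listDeriv (idxList J.1) (localExpr c (underlying σ) α) := by
    intro α J
    refine (eventuallyEq_listDeriv_of_holonomic (u := fun y => (secExpr c σ y).1.2 α) ?_
      (idxList J.1) J (count_idxList J.1)).trans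
        (listDeriv_congr (localExpr_underlying hσ.1 hx α).symm _)
    filter_upwards [eventually_localSolution hL hX hσ hx hxU] with y hy i I
    exact hy.holonomic α i I
  filter_upwards [eventually_chart hσ.1 hx,
    Filter.eventually_all.2 fun α => Filter.eventually_all.2 fun J => h1 α J] with y h2 h3
  exact Prod.ext (secExpr_fst_fst hσ.1 h2.1) (funext fun α => funext fun J => h3 α J)

theorem contDiffAt_multiplier (hC : (σ x).jet ∈ C) (hL : Jet.SmoothOn L Set.univ)
    (hX : ∀ x, (σ x).jet ∈ Q.U → DynamicalEq η L Q.Ψ (lam (σ x)) (X (σ x)))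
    (hσ : IsIntegralSection X σ) (hx : σ x ∈ dom c) (hxU : (σ x).jet ∈ Q.U) :
    ContDiffAt ℝ ∞ (fun y => lam (σ (c.base.symm y))) (c.base x) := by
  have hs := secExpr_base hσ.1 hx
  refine FieldTheory.contDiffAt_multiplier
    (A := fun μ y => fderiv ℝ (Jet.rep c (Q.Ψ μ)) (secExpr c σ y).1) (fun μ v => ?_) ?_ fun v => ?_
  · have h1 : ContDiffAt ℝ ∞ (fun z => fderiv ℝ (Jet.rep c (Q.Ψ μ)) z v)
        (secExpr c σ (c.base x)).1 := by
      rw [hs]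
      exact contDiffAt_fderiv_apply (Q.smooth μ _ hxU c hx) v
    exact h1.comp (c.base x) (contDiffAt_secExpr hσ.1 hx).fst
  · rw [hs]
    exact Q.indep _ ⟨hxU, hC⟩ c hx
  · simp only [← covector_apply]
    exact LocalSolution.contDiffAt_covector (eventually_localSolution hL hX hσ hx hxU) v

theorem contMDiffAt_multiplier (hC : ∀ x, (σ x).jet ∈ C) (hL : Jet.SmoothOn L Set.univ)
    (hX : ∀ x, (σ x).jet ∈ Q.U → DynamicalEq η L Q.Ψ (lam (σ x)) (X (σ x)))
    (hσ : IsIntegralSection X σ) (hxU : (σ x).jet ∈ Q.U) :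
    ContMDiffAt (𝓡 m) 𝓘(ℝ, Fin l → ℝ) ∞ (fun x => lam (σ x)) x := by
  obtain ⟨c, hx⟩ := π.exists_chart (underlying σ x)
  replace hx : σ x ∈ dom c := hx
  have hb := hσ.1.mem_base hx
  have h1 := (contDiffAt_multiplier (hC x) hL hX hσ hx hxU).contMDiffAt.comp x
    (c.base_smooth.1.contMDiffAt (c.base.open_source.mem_nhds hb))
  refine h1.congr_of_eventuallyEq ?_
  filter_upwards [c.base.open_source.mem_nhds hb] with x' hx'
  rw [Function.comp_apply, c.base.left_inv hx']

/-- Holonomy turns the identity for partial derivatives along σ into one for total derivatives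
evaluated on the lifts of φ. -/
theorem eulerLagrangeAt (hC : ∀ x, (σ x).jet ∈ C) (hL : Jet.SmoothOn L Set.univ)
    (hX : ∀ x, (σ x).jet ∈ Q.U → DynamicalEq η L Q.Ψ (lam (σ x)) (X (σ x)))
    (hσ : IsIntegralSection X σ) (hx : σ x ∈ dom c) (hxU : (σ x).jet ∈ Q.U) :
    EulerLagrangeAt η L Q.Ψ (fun x => lam (σ x)) (isSection_underlying hσ.1) c x := by
  intro α
  have hpro := secExpr_eq_prolong hL hX hσ hx hxU
  have hφ : ∀ α, ∀ᶠ y in 𝓝 (c.base x), ContDiffAt ℝ ∞ (localExpr c (underlying σ) α) y :=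
    Filter.eventually_all.1 (contDiffAt_localExpr_underlying hσ.1 hx)
  refine (Finset.sum_congr rfl fun J _ => ?_).trans
    (LocalSolution.eulerLagrange (eventually_localSolution hL hX hσ hx hxU) α)
  congr 1
  rw [Jet.coord_jetLift _ hx]
  refine (iterTotal_prolong hφ ?_ (idxList J.1)).2.eq_of_nhds.trans
    (listDeriv_congr ?_ _).eq_of_nhds
  -- The integrand, as a function on jets, must be smooth at all nearby jets of φ; the multipliers
  -- enter it through the base point, and their smoothness is used here.
  · filter_upwards [hpro, eventually_chart hσ.1 hx, eventually_mem hσ.1 hx Q.isOpen_U hxU]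
      with y h1 h2 h3
    have hy := c.base.right_inv h2.1
    have hs : (secExpr c σ y).1 = Jet.coord c (σ (c.base.symm y)).jet := rfl
    have hz : (secExpr c σ y).1.1 = y := secExpr_fst_fst hσ.1 h2.1
    have hρ : ContDiffAt ℝ ∞ (density η.form c.base) y :=
      (η.smooth _ c.base_smooth).contDiffAt (c.base.open_target.mem_nhds h2.1)
    have hlam : ContDiffAt ℝ ∞ (fun y => lam (σ (c.base.symm y))) y := by
      have := contDiffAt_multiplier (hC _) hL hX hσ h2.2.1 h3
      rwa [hy] at this
    rw [← h1]
    have hfst : ContDiffAt ℝ ∞ (fun z : JC m n (r + 1) => z.1) (secExpr c σ y).1 :=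
      contDiffAt_fst
    rw [← hz] at hρ hlam
    refine (hρ.comp _ hfst).mul (ContDiffAt.sub ?_ (ContDiffAt.sum fun μ _ => ContDiffAt.mul ?_ ?_))
    · exact contDiffAt_fderiv_apply (hs ▸ hL _ (Set.mem_univ _) c h2.2.1) _
    · exact (contDiffAt_pi.1 hlam μ).comp _ hfst
    · exact contDiffAt_fderiv_apply (hs ▸ Q.smooth μ _ h3 c h2.2.1) _
  · filter_upwards [hpro] with y hy
    rw [covector_apply, hy]
    rfl

theorem jet_eq_jetLift (hL : Jet.SmoothOn L Set.univ) (hσ : IsIntegralSection X σ)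
    (hX : ∀ x, (σ x).jet ∈ Q.U → DynamicalEq η L Q.Ψ (lam (σ x)) (X (σ x)))
    (hxU : (σ x).jet ∈ Q.U) :
    (σ x).jet = jetLift (r + 1) (isSection_underlying hσ.1) x := by
  refine Jet.eq_mk (hσ.1.1 x) _ rfl fun c hx α I => ?_
  have h1 := (secExpr_eq_prolong hL hX hσ (c := c) hx hxU).self_of_nhds
  rw [secExpr_base hσ.1 hx] at h1
  exact congrFun (congrFun (congrArg Prod.snd h1) α) I

end W

end

end FieldTheory

end

/-! ### The global theorem -/

open FieldTheory in
theorem mainTheorem2 {m n r l : ℕ} {M E : Type*}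
    [TopologicalSpace M] [ChartedSpace (EuclideanSpace ℝ (Fin m)) M] [IsManifold (𝓡 m) ∞ M]
    [TopologicalSpace E] [ChartedSpace (EuclideanSpace ℝ (Fin (m + n))) E]
    [IsManifold (𝓡 (m + n)) ∞ E]
    (π : FibredManifold m n M E) (η : VolumeForm m M)
    (L : Jet π (r + 1) → ℝ) (hL : Jet.SmoothOn L Set.univ)
    (C : Set (Jet π (r + 1)))
    {ι : Type*} (Q : ι → LocalConstraint C l) (hQ : ∀ j ∈ C, ∃ a, j ∈ (Q a).U)
    (N : Set (W π r)) (hN : N ⊆ W.constrained η L C)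
    (X : ∀ w : W π r, W.MultiVector w) (lam : ι → W π r → Fin l → ℝ)
    (hX : ∀ a, ∀ w ∈ N, w.jet ∈ (Q a).U → W.DynamicalEq η L (Q a).Ψ (lam a w) (X w))
    (σ : M → W π r) (hσN : ∀ x, σ x ∈ N) (hσ : W.IsIntegralSection X σ) :
    ∃ (φ : M → E) (hφ : IsSection π φ),
      (∀ x, (σ x).jet = jetLift (r + 1) hφ x) ∧
      (∀ x, jetLift (r + 1) hφ x ∈ C) ∧
      ∀ a,
        ContMDiffOn (𝓡 m) 𝓘(ℝ, Fin l → ℝ) ∞ (fun x => lam a (σ x)) {x | (σ x).jet ∈ (Q a).U} ∧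
        ∀ (c : π.Chart) (x : M), φ x ∈ c.total.source → (σ x).jet ∈ (Q a).U →
          EulerLagrangeAt η L (Q a).Ψ (fun y => lam a (σ y)) hφ c x := by
  have hC : ∀ x, (σ x).jet ∈ C := fun x => (hN (hσN x)).1
  have hX' : ∀ a x, (σ x).jet ∈ (Q a).U → W.DynamicalEq η L (Q a).Ψ (lam a (σ x)) (X (σ x)) :=
    fun a x => hX a (σ x) (hσN x)
  -- The section φ is defined globally from σ, without reference to the cover, so any constraint
  -- chart around a given point suffices to prove holonomy there.
  have hj : ∀ x, (σ x).jet = jetLift (r + 1) (W.isSection_underlying hσ.1) x := by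
    intro x
    obtain ⟨a, ha⟩ := hQ _ (hC x)
    exact W.jet_eq_jetLift hL hσ (hX' a) ha
  refine ⟨W.underlying σ, W.isSection_underlying hσ.1, hj, fun x => hj x ▸ hC x, fun a => ⟨?_, ?_⟩⟩
  · exact fun x hx => (W.contMDiffAt_multiplier hC hL (hX' a) hσ hx).contMDiffWithinAt
  · exact fun c x hx hxU => W.eulerLagrangeAt hC hL (hX' a) hσ hx hxU
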